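/- Say that \(\xi\in\mathbb R^2\) has Diophantine index \(\sigma>0\) if there is \(C_\xi>0\) such that \(|\xi\cdot\kappa|\ge C_\xi|\kappa|^{-\sigma}\) for all \(\kappa\in\mathbb Z^2\setminus\{0\}\), where \(|\cdot|\) is the Euclidean norm (so \(\xi\) is non-resonant). For \(\gamma>0\) let \(\mathbf U(x_1,x_2)=\bigl(2-\sin(2\pi x_1)-\sin(2\pi x_2)\bigr)^{\gamma}\) on the torus \(\mathbb T^2=\mathbb R^2/\mathbb Z^2\) (with its normalized Lebesgue measure), and put \[ A_\xi(T)=\frac1T\int_0^T\frac{dx}{\mathbf U(\xi x)^{1/2}},\qquad T>0 . \] Let \(\xi\in\mathbb R^2\) have Diophantine index \(1\) and let \(\gamma>0\). Then \(\mathbf U(\xi x)>0\) for all \(x\in\mathbb R\), so that \(A_\xi(T)\) is well defined and finite for every \(T>0\), and there is a constant \(C=C(\gamma,\xi)>0\) such that: 1. If \(\gamma>2\), then \(A_\xi(T)\ge C\,T^{\tau}\) for all \(T>0\), where \(\displaystyle\tau=\frac{(\gamma-2)(3\gamma-2)}{(\gamma-2)(3\gamma-2)+4\gamma^2}\). 2.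 If \(\gamma=2\), then \(A_\xi(T)\ge C\,|\log T|\) for all \(T\ge 1\). 3. If \(\gamma<2\), then \(\mathbf U^{-1/2}\in L^1(\mathbb T^2)\), and with \(M=\int_{\mathbb T^2}\mathbf U(\mathbf x)^{-1/2}\,d\mathbf x\), - if \(\gamma\in[1,2)\): \(|A_\xi(T)-M|\le C\,T^{-\tau}\) for all \(T>0\), where \(\tau=\frac12\cdot\frac{2-\gamma}{2+\gamma}\); - if \(\gamma\in(\frac23,1)\): \(|A_\xi(T)-M|\le C\,T^{-\tau}\) for all \(T>0\), where \(\tau=\frac{\gamma}{1+\gamma}\cdot\frac{2-\gamma}{2+\gamma}\); - if \(\gamma=\frac23\): \(|A_\xi(T)-M|\le C\,T^{-1/5}|\log T|\) for all \(T\ge 2\); - if \(\gamma\in(0,\frac23)\): \(|A_\xi(T)-M|\le C\,T^{-\tau}\) for all \(T>0\), where \(\tau=\frac12\cdot\frac{\gamma}{1+\gamma}\). Furthermore, for \(\gamma>2\) the assertions (positivity of \(\mathbf U(\xi x)\) and the lower bound in 1, with \(C=C(\gamma,\xi)>0\)) hold for every \(\xi\in\mathbb R^2\) that has some Diophantine index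 \(\sigma<2\). -/

import Mathlib

open MeasureTheory

/-- `ξ ∈ ℝⁿ` has Diophantine index `σ > 0`: for some `C > 0`, `|ξ · κ| ≥ C |κ|^{-σ}` for every
nonzero `κ ∈ ℤⁿ`, where `|κ|` is the Euclidean length. Such a `ξ` is in particular non-resonant. -/
def HasDiophantineIndex {n : ℕ} (ξ : Fin n → ℝ) (σ : ℝ) : Prop :=
  0 < σ ∧ ∃ C : ℝ, 0 < C ∧ ∀ κ : Fin n → ℤ, κ ≠ 0 →
    C * (√(∑ i, (κ i : ℝ) ^ 2)) ^ (-σ) ≤ |∑ i, ξ i * (κ i : ℝ)|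

theorem periodic_sin_two_pi :
    Function.Periodic (fun t : ℝ => Real.sin (2 * Real.pi * t)) 1 := by
  intro t
  simp only [mul_add, mul_one, Real.sin_add_two_pi]

/-- The function `t ↦ sin (2πt)` on the circle `ℝ / ℤ`. -/
noncomputable def circleSin : UnitAddCircle → ℝ := periodic_sin_two_pi.lift

/-- The prototype potential `U(x₁, x₂) = (2 - sin 2πx₁ - sin 2πx₂)^γ` on the torus `𝕋²`. -/
noncomputable def prototypeU (γ : ℝ) (x : UnitAddTorus (Fin 2)) : ℝ :=
  (2 - circleSin (x 0) - circleSin (x 1)) ^ γ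

/-- The point `ξ t` of the linear flow, as a point of the torus. -/
noncomputable def torusFlow {n : ℕ} (ξ : Fin n → ℝ) (t : ℝ) : UnitAddTorus (Fin n) :=
  fun i => ((ξ i * t : ℝ) : UnitAddCircle)

/-- The Birkhoff average `(1/T) ∫₀ᵀ U(ξx)^{-1/2} dx`. -/
noncomputable def birkhoffMean (γ : ℝ) (ξ : Fin 2 → ℝ) (T : ℝ) : ℝ :=
  (1 / T) * ∫ x in (0 : ℝ)..T, 1 / √(prototypeU γ (torusFlow ξ x))

/-- The space average `∫_{𝕋²} U^{-1/2}` with respect to the normalized Lebesgue measure. -/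
noncomputable def torusMean (γ : ℝ) : ℝ :=
  ∫ x : UnitAddTorus (Fin 2), 1 / √(prototypeU γ x)

/-- The integrand `U(ξx)^{-1/2}` is a genuine (finite, locally integrable) function on `ℝ`. -/
def WellDefinedAlongFlow (γ : ℝ) (ξ : Fin 2 → ℝ) : Prop :=
  (∀ x : ℝ, 0 < prototypeU γ (torusFlow ξ x)) ∧
    ∀ a b : ℝ, IntervalIntegrable (fun x => 1 / √(prototypeU γ (torusFlow ξ x))) volume a b

/-- The growth exponent for `γ > 2`. -/
noncomputable def growthExponent (γ : ℝ) : ℝ :=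
  (γ - 2) * (3 * γ - 2) / ((γ - 2) * (3 * γ - 2) + 4 * γ ^ 2)

/-! With w = `singularDist`, the integrand is w^(-γ), and w is comparable to the sup distance to the
zero (1/4, 1/4). The question is about averages of an inverse power of a distance, which in
dimension two is critical at γ = 2.

Dirichlet's theorem gives coprime (a, b) such that for a time L = |a|/|ξ 0| the orbit stays
1/|a|-close to a translate of the closed geodesic of direction (a, b), which is itself 1/|a|-dense.
So an orbit piece of length L shadows every translate of that geodesic up to 2/|a|, and averaging
over the translates produces the space average (`IsAlmostPeriod.mul_integral_le`). The Diophantine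
index bounds |a| from below (`HasDiophantineIndex.exists_isAlmostPeriod`).

For γ ≥ 2 the time average over [0, T] is at least half the space average of (w + 21/q)^(-γ) with q
= |a| and q^σ ≥ cT, which is at least of order q^(γ-2), or log q when γ = 2. For σ ≤ 2 this gives
the exponent (γ-2)/2, no smaller than the required one.

For γ < 2 replace w by max w δ. The space error is O(δ^(2-γ)), and so is the time error, because the
orbit spends a time O(T r²) where w ≤ r (`HasDiophantineIndex.exists_volume_visits_le`). The
truncation has Lipschitz constant O(δ^(-γ-1)), so it equidistributes with error O(T^(-1/2)
δ^(-γ-1)). The choice δ = T^(-1/6) balances the two and gives the rate T^(-(2-γ)/6), at least as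
good as all four stated rates. -/

/-! ### The distance to the zero of the potential. -/

/-- The zero `(1/4, 1/4)` of the potential. -/
noncomputable def singularPoint : UnitAddTorus (Fin 2) := fun _ => ((1 / 4 : ℝ) : UnitAddCircle)

/-- `√(2 - sin 2πx₁ - sin 2πx₂)`, which is comparable to the distance to `singularPoint`. -/
noncomputable def singularDist (x : UnitAddTorus (Fin 2)) : ℝ :=
  √(2 - circleSin (x 0) - circleSin (x 1))

theorem circleSin_coe (t : ℝ) : circleSin (t : UnitAddCircle) = Real.sin (2 * Real.pi * t) := rfl

theorem one_sub_sin_two_pi (t : ℝ) :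
    1 - Real.sin (2 * Real.pi * t) = 2 * Real.sin (Real.pi * (t - 1 / 4)) ^ 2 := by
  have h : 2 * Real.pi * t = Real.pi / 2 + 2 * (Real.pi * (t - 1 / 4)) := by ring
  rw [h, Real.sin_add, Real.sin_pi_div_two, Real.cos_pi_div_two, Real.cos_two_mul,
    Real.cos_sq']
  ring

theorem circleSin_le_one (u : UnitAddCircle) : circleSin u ≤ 1 := by
  induction u using QuotientAddGroup.induction_on with
  | H t => exact Real.sin_le_one _

theorem neg_one_le_circleSin (u : UnitAddCircle) : -1 ≤ circleSin u := by
  induction u using QuotientAddGroup.induction_on with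
  | H t => exact Real.neg_one_le_sin _

theorem continuous_circleSin : Continuous circleSin := by
  refine continuous_coinduced_dom.mpr ?_
  change Continuous fun t : ℝ => Real.sin (2 * Real.pi * t)
  fun_prop

theorem UnitAddCircle.exists_lift_norm_eq (u : UnitAddCircle) :
    ∃ t : ℝ, (t : UnitAddCircle) = u ∧ |t| = ‖u‖ := by
  induction u using QuotientAddGroup.induction_on with
  | H t =>
    refine ⟨t - round t, ?_, UnitAddCircle.norm_eq.symm⟩
    have : ((round t : ℝ) : UnitAddCircle) = 0 := by
      have := AddCircle.coe_eq_zero_iff (p := (1 : ℝ)) (x := (round t : ℝ))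
      exact this.2 ⟨round t, by simp⟩
    rw [AddCircle.coe_sub, this, sub_zero]

theorem UnitAddCircle.norm_coe_le_abs_sub_intCast (t : ℝ) (k : ℤ) :
    ‖(t : UnitAddCircle)‖ ≤ |t - k| := by
  rw [UnitAddCircle.norm_eq]
  exact round_le t k

theorem singularDist_nonneg (x : UnitAddTorus (Fin 2)) : 0 ≤ singularDist x := Real.sqrt_nonneg _

theorem sq_singularDist (x : UnitAddTorus (Fin 2)) :
    singularDist x ^ 2 = 2 - circleSin (x 0) - circleSin (x 1) :=
  Real.sq_sqrt (by linarith [circleSin_le_one (x 0), circleSin_le_one (x 1)])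

theorem singularDist_le_two (x : UnitAddTorus (Fin 2)) : singularDist x ≤ 2 := by
  refine abs_le_of_sq_le_sq' ?_ (by norm_num) |>.2
  rw [sq_singularDist]
  linarith [neg_one_le_circleSin (x 0), neg_one_le_circleSin (x 1)]

theorem continuous_singularDist : Continuous singularDist := by
  unfold singularDist
  have := continuous_circleSin
  fun_prop

theorem sq_singularDist_coe (s t : ℝ) (x : UnitAddTorus (Fin 2))
    (h0 : (s : UnitAddCircle) = x 0) (h1 : (t : UnitAddCircle) = x 1) :
    singularDist x ^ 2 = 2 * Real.sin (Real.pi * (s - 1 / 4)) ^ 2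
      + 2 * Real.sin (Real.pi * (t - 1 / 4)) ^ 2 := by
  rw [sq_singularDist, ← h0, ← h1, circleSin_coe, circleSin_coe, ← one_sub_sin_two_pi,
    ← one_sub_sin_two_pi]
  ring

/-- The map t ↦ sin (πt) is 3.2-Lipschitz, and w² = 2A² + 2B² forces |A| + |B| ≤ w; expanding the
square then leaves room to spare in the constant 10. -/
theorem le_singularDist_add (x y : UnitAddTorus (Fin 2)) :
    singularDist x ≤ singularDist y + 10 * dist x y := by
  obtain ⟨s, hs⟩ := QuotientAddGroup.mk_surjective (y 0)
  obtain ⟨t, ht⟩ := QuotientAddGroup.mk_surjective (y 1)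
  obtain ⟨u, hu, hu'⟩ := UnitAddCircle.exists_lift_norm_eq (x 0 - y 0)
  obtain ⟨v, hv, hv'⟩ := UnitAddCircle.exists_lift_norm_eq (x 1 - y 1)
  have hx := sq_singularDist_coe (s + u) (t + v) x
    (by rw [AddCircle.coe_add, hu, hs]; abel)
    (by rw [AddCircle.coe_add, hv, ht]; abel)
  have hy := sq_singularDist_coe s t y hs ht
  have hud : |u| ≤ dist x y := by rw [hu', ← dist_eq_norm]; exact dist_le_pi_dist x y 0
  have hvd : |v| ≤ dist x y := by rw [hv', ← dist_eq_norm]; exact dist_le_pi_dist x y 1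
  have hsin : ∀ p q : ℝ, |Real.sin (Real.pi * (p + q - 1 / 4)) - Real.sin (Real.pi * (p - 1 / 4))|
      ≤ 3.2 * |q| := by
    intro p q
    have h1 := Real.abs_sin_sub_sin_le (Real.pi * (p + q - 1 / 4)) (Real.pi * (p - 1 / 4))
    have h2 : Real.pi * (p + q - 1 / 4) - Real.pi * (p - 1 / 4) = Real.pi * q := by ring
    rw [h2, abs_mul, abs_of_pos Real.pi_pos] at h1
    refine h1.trans ?_
    gcongr
    linarith [Real.pi_lt_d2]
  have hA := hsin s u
  have hB := hsin t v
  generalize Real.sin (Real.pi * (s + u - 1 / 4)) = A' at *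
  generalize Real.sin (Real.pi * (s - 1 / 4)) = A at *
  generalize Real.sin (Real.pi * (t + v - 1 / 4)) = B' at *
  generalize Real.sin (Real.pi * (t - 1 / 4)) = B at *
  have hd : 0 ≤ dist x y := dist_nonneg
  have hw := singularDist_nonneg y
  generalize singularDist y = w at *
  refine abs_le_of_sq_le_sq' ?_ (by positivity) |>.2
  rw [hx]
  have hA1 : |A' - A| ≤ 3.2 * dist x y := by linarith
  have hB1 : |B' - B| ≤ 3.2 * dist x y := by linarith
  generalize dist x y = d at *
  have hAB : |A| + |B| ≤ w := by
    refine abs_le_of_sq_le_sq' ?_ hw |>.2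
    rw [hy]
    nlinarith [sq_abs A, sq_abs B, sq_nonneg (|A| - |B|)]
  have e1 : 2 * A' ^ 2 + 2 * B' ^ 2
      = w ^ 2 + 4 * (A * (A' - A) + B * (B' - B)) + 2 * (A' - A) ^ 2 + 2 * (B' - B) ^ 2 := by
    rw [hy]; ring
  have e2 : A * (A' - A) ≤ |A| * (3.2 * d) := by
    refine (le_abs_self _).trans ?_
    rw [abs_mul]; gcongr
  have e3 : B * (B' - B) ≤ |B| * (3.2 * d) := by
    refine (le_abs_self _).trans ?_
    rw [abs_mul]; gcongr
  have e4 : (A' - A) ^ 2 ≤ (3.2 * d) ^ 2 := sq_le_sq' (abs_le.1 hA1).1 (abs_le.1 hA1).2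
  have e5 : (B' - B) ^ 2 ≤ (3.2 * d) ^ 2 := sq_le_sq' (abs_le.1 hB1).1 (abs_le.1 hB1).2
  have e6 : (|A| + |B|) * (3.2 * d) ≤ w * (3.2 * d) := by gcongr
  nlinarith [mul_nonneg hw hd, sq_nonneg d]

theorem singularDist_singularPoint : singularDist singularPoint = 0 := by
  have := sq_singularDist_coe (1 / 4) (1 / 4) singularPoint rfl rfl
  simpa using this

theorem singularDist_le (x : UnitAddTorus (Fin 2)) :
    singularDist x ≤ 10 * dist x singularPoint := by
  simpa [singularDist_singularPoint] using le_singularDist_add x singularPoint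

/-- Jordan's inequality |sin πu| ≥ 2|u| for |u| ≤ 1/2, applied to the representatives of smallest
absolute value. -/
theorem dist_singularPoint_le (x : UnitAddTorus (Fin 2)) :
    dist x singularPoint ≤ singularDist x := by
  have key : ∀ u : ℝ, |u| ≤ 1 / 2 → u ^ 2 ≤ 2 * Real.sin (Real.pi * u) ^ 2 := by
    intro u hu
    have h1 : 2 / Real.pi * |Real.pi * u| ≤ |Real.sin (Real.pi * u)| := by
      apply Real.mul_abs_le_abs_sin
      rw [abs_mul, abs_of_pos Real.pi_pos]
      nlinarith [Real.pi_pos]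
    rw [abs_mul, abs_of_pos Real.pi_pos, ← mul_assoc, div_mul_cancel₀ _ Real.pi_ne_zero] at h1
    nlinarith [sq_abs u, sq_abs (Real.sin (Real.pi * u)), abs_nonneg u]
  obtain ⟨u, hu, hu'⟩ := UnitAddCircle.exists_lift_norm_eq (x 0 - singularPoint 0)
  obtain ⟨v, hv, hv'⟩ := UnitAddCircle.exists_lift_norm_eq (x 1 - singularPoint 1)
  have hx := sq_singularDist_coe (1 / 4 + u) (1 / 4 + v) x
    (by rw [AddCircle.coe_add, hu]; exact add_sub_cancel _ _)
    (by rw [AddCircle.coe_add, hv]; exact add_sub_cancel _ _)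
  rw [add_sub_cancel_left, add_sub_cancel_left] at hx
  have hu2 : |u| ≤ 1 / 2 := by
    rw [hu']; simpa using AddCircle.norm_le_half_period (1 : ℝ) one_ne_zero (x := x 0 - singularPoint 0)
  have hv2 : |v| ≤ 1 / 2 := by
    rw [hv']; simpa using AddCircle.norm_le_half_period (1 : ℝ) one_ne_zero (x := x 1 - singularPoint 1)
  refine (dist_pi_le_iff (singularDist_nonneg x)).2 fun i => ?_
  rw [dist_eq_norm]
  fin_cases i
  · change ‖x 0 - singularPoint 0‖ ≤ _
    rw [← hu']
    refine abs_le_of_sq_le_sq ?_ (singularDist_nonneg x)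
    nlinarith [key u hu2, sq_nonneg (Real.sin (Real.pi * v))]
  · change ‖x 1 - singularPoint 1‖ ≤ _
    rw [← hv']
    refine abs_le_of_sq_le_sq ?_ (singularDist_nonneg x)
    nlinarith [key v hv2, sq_nonneg (Real.sin (Real.pi * u))]

theorem prototypeU_eq (γ : ℝ) (x : UnitAddTorus (Fin 2)) :
    prototypeU γ x = (singularDist x ^ 2) ^ γ := by
  rw [sq_singularDist]; rfl

theorem one_div_sqrt_prototypeU (γ : ℝ) (x : UnitAddTorus (Fin 2)) :
    1 / √(prototypeU γ x) = singularDist x ^ (-γ) := by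
  have h := singularDist_nonneg x
  rw [prototypeU_eq, ← Real.rpow_natCast, ← Real.rpow_mul h, mul_comm, Real.rpow_mul h,
    Nat.cast_ofNat, Real.rpow_two, Real.sqrt_sq (Real.rpow_nonneg h _), Real.rpow_neg h, one_div]

/-! ### The linear flow, closed geodesics and almost periods. -/

instance UnitAddTorus.isProbabilityMeasure_volume {d : Type*} [Fintype d] :
    IsProbabilityMeasure (volume : Measure (UnitAddTorus d)) := by
  have : IsProbabilityMeasure (volume : Measure UnitAddCircle) := ⟨UnitAddCircle.measure_univ⟩
  exact inferInstanceAs (IsProbabilityMeasure (Measure.pi fun _ : d => volume))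

theorem torusFlow_add {n : ℕ} (ξ : Fin n → ℝ) (s t : ℝ) :
    torusFlow ξ (s + t) = torusFlow ξ s + torusFlow ξ t := by
  funext i
  simp [torusFlow, mul_add]

theorem continuous_torusFlow {n : ℕ} (ξ : Fin n → ℝ) : Continuous (torusFlow ξ) := by
  refine continuous_pi fun i => ?_
  exact (AddCircle.continuous_mk' 1).comp (by fun_prop)

theorem torusFlow_intCast_one {n : ℕ} (m : Fin n → ℤ) :
    torusFlow (fun i => (m i : ℝ)) 1 = 0 := by
  funext i
  exact (AddCircle.coe_eq_zero_iff (1 : ℝ)).2 ⟨m i, by simp⟩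

theorem UnitAddTorus.dist_coe_le {n : ℕ} {u v : Fin n → ℝ} {ρ : ℝ} (hρ : 0 ≤ ρ) (k : Fin n → ℤ)
    (h : ∀ i, |u i - v i - k i| ≤ ρ) :
    dist (fun i => (u i : UnitAddCircle) : UnitAddTorus (Fin n))
      (fun i => (v i : UnitAddCircle)) ≤ ρ := by
  refine (dist_pi_le_iff hρ).2 fun i => ?_
  rw [dist_eq_norm, ← AddCircle.coe_sub]
  exact (UnitAddCircle.norm_coe_le_abs_sub_intCast _ (k i)).trans (h i)

/-- The closed geodesic in a primitive integer direction `(a, b)` is `1 / |a|`-dense. -/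
theorem exists_dist_torusFlow_intCast_le {m : Fin 2 → ℤ} (hm : IsCoprime (m 0) (m 1))
    (h0 : m 0 ≠ 0) (z : UnitAddTorus (Fin 2)) :
    ∃ s : ℝ, dist z (torusFlow (fun i => (m i : ℝ)) s) ≤ 1 / |(m 0 : ℝ)| := by
  have h0' : (m 0 : ℝ) ≠ 0 := by exact_mod_cast h0
  have hpos : 0 < |(m 0 : ℝ)| := abs_pos.2 h0'
  obtain ⟨z0, hz0⟩ := QuotientAddGroup.mk_surjective (z 0)
  obtain ⟨z1, hz1⟩ := QuotientAddGroup.mk_surjective (z 1)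
  obtain ⟨u, v, huv⟩ := hm
  set N : ℤ := round (m 0 * z1 - m 1 * z0) with hN
  have hround : |m 0 * z1 - m 1 * z0 - N| ≤ 1 / 2 := abs_sub_round _
  have huv' : (u : ℝ) * m 0 + v * m 1 = 1 := by exact_mod_cast huv
  -- This time matches the first coordinate exactly modulo 1. By the Bézout relation the second is
  -- then off by (m 0 * z1 - m 1 * z0 - N) / m 0 modulo 1, and N is the nearest integer.
  refine ⟨(z0 + N * v) / m 0, ?_⟩
  have hz : z = fun i => ((![z0, z1] i : ℝ) : UnitAddCircle) := by
    funext i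
    fin_cases i
    · exact hz0.symm
    · exact hz1.symm
  rw [hz]
  refine UnitAddTorus.dist_coe_le (by positivity) ![-(N * v), N * u] fun i => ?_
  fin_cases i
  · have : z0 - m 0 * ((z0 + N * v) / m 0) - -(N * v) = 0 := by field_simp; ring
    simp only [Fin.zero_eta, Matrix.cons_val_zero, Int.cast_neg, Int.cast_mul]
    rw [this, abs_zero]
    positivity
  · have : z1 - m 1 * ((z0 + N * v) / m 0) - N * u = (m 0 * z1 - m 1 * z0 - N) / m 0 := by
      field_simp
      linear_combination (-N : ℝ) * huv'
    simp only [Fin.mk_one, Matrix.cons_val_one, Matrix.cons_val_zero, Int.cast_mul]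
    rw [this, abs_div]
    gcongr
    linarith

/-- `L` is a time after which the flow in direction `ξ` closes up to `1 / |a|`, in the homotopy class
of a primitive integer vector `m = (a, b)` with `a ≠ 0`. -/
structure IsAlmostPeriod (ξ : Fin 2 → ℝ) (m : Fin 2 → ℤ) (L : ℝ) : Prop where
  pos : 0 < L
  coprime : IsCoprime (m 0) (m 1)
  ne_zero : m 0 ≠ 0
  mul_eq : L * ξ 0 = m 0
  abs_sub_le : |L * ξ 1 - m 1| ≤ 1 / |(m 0 : ℝ)|

theorem IsAlmostPeriod.dist_torusFlow_le {ξ : Fin 2 → ℝ} {m : Fin 2 → ℤ} {L : ℝ}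
    (h : IsAlmostPeriod ξ m L) {s : ℝ} (hs : s ∈ Set.Icc (0 : ℝ) 1) :
    dist (torusFlow ξ (L * s)) (torusFlow (fun i => (m i : ℝ)) s) ≤ 1 / |(m 0 : ℝ)| := by
  refine UnitAddTorus.dist_coe_le (by positivity) 0 fun i => ?_
  fin_cases i
  · have : ξ 0 * (L * s) - m 0 * s = 0 := by rw [← h.mul_eq]; ring
    simp only [Fin.zero_eta, Pi.zero_apply, Int.cast_zero, sub_zero]
    rw [this, abs_zero]
    positivity
  · have : ξ 1 * (L * s) - m 1 * s = (L * ξ 1 - m 1) * s := by ring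
    simp only [Fin.mk_one, Pi.zero_apply, Int.cast_zero, sub_zero]
    rw [this, abs_mul, abs_of_nonneg hs.1]
    calc _ ≤ 1 / |(m 0 : ℝ)| * 1 := by
          gcongr
          · exact hs.1
          · exact h.abs_sub_le
          · exact hs.2
      _ = _ := mul_one _

/-! ### Time averages against space averages over almost periods. -/

/-- Fubini and translation invariance: for each fixed s the integral over y does not see the shift.
-/
theorem integral_integral_torusFlow {n : ℕ} (m : Fin n → ℝ) {h : UnitAddTorus (Fin n) → ℝ}
    (hh : Continuous h) :
    ∫ y, ∫ s in (0 : ℝ)..1, h (y + torusFlow m s) = ∫ y, h y := by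
  have hflow := continuous_torusFlow m
  have hc : Continuous fun p : UnitAddTorus (Fin n) × ℝ => h (p.1 + torusFlow m p.2) := by fun_prop
  obtain ⟨B, hB⟩ := (isCompact_univ (X := UnitAddTorus (Fin n))).exists_bound_of_continuousOn
    hh.continuousOn
  simp only [intervalIntegral.integral_of_le zero_le_one]
  rw [integral_integral_swap]
  · simp [integral_add_right_eq_self]
  · exact Integrable.of_bound hc.aestronglyMeasurable B
      (Filter.Eventually.of_forall fun p => hB _ (Set.mem_univ _))

/-- If `h ≤ g` up to displacements of size `2 / |a|`, the space average of `h` is at most the time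
average of `g` over an almost period. -/
theorem IsAlmostPeriod.mul_integral_le {ξ : Fin 2 → ℝ} {m : Fin 2 → ℤ} {L : ℝ}
    (hL : IsAlmostPeriod ξ m L) {g h : UnitAddTorus (Fin 2) → ℝ} (hg : Continuous g)
    (hh : Continuous h) (hgh : ∀ x y, dist x y ≤ 2 / |(m 0 : ℝ)| → h y ≤ g x) (t₀ : ℝ) :
    L * ∫ y, h y ≤ ∫ t in t₀..t₀ + L, g (torusFlow ξ t) := by
  set M : Fin 2 → ℝ := fun i => (m i : ℝ) with hM
  have hfξ := continuous_torusFlow ξ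
  have hfM := continuous_torusFlow M
  have hkey : ∀ y, L * ∫ s in (0 : ℝ)..1, h (y + torusFlow M s) ≤
      ∫ t in t₀..t₀ + L, g (torusFlow ξ t) := by
    intro y
    -- Density supplies the parameter s₀ at which the translate through y passes near the starting
    -- point of the orbit; periodicity permits starting there.
    obtain ⟨s₀, hs₀⟩ := exists_dist_torusFlow_intCast_le hL.coprime hL.ne_zero
      (torusFlow ξ t₀ - y)
    have hper : Function.Periodic (fun s => h (y + torusFlow M s)) 1 := by
      intro s
      simp only [torusFlow_add, torusFlow_intCast_one, hM, add_zero]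
    have h1 : ∫ s in (0 : ℝ)..1, h (y + torusFlow M s)
        = ∫ s in (0 : ℝ)..1, h (y + torusFlow M (s + s₀)) := by
      rw [intervalIntegral.integral_comp_add_right (fun s => h (y + torusFlow M s)) s₀]
      have := hper.intervalIntegral_add_eq 0 s₀
      rw [zero_add] at this ⊢
      rw [this, add_comm]
    have h2 : ∫ t in t₀..t₀ + L, g (torusFlow ξ t)
        = L * ∫ s in (0 : ℝ)..1, g (torusFlow ξ (t₀ + L * s)) := by
      rw [intervalIntegral.integral_comp_add_mul (fun s => g (torusFlow ξ s)) hL.pos.ne', smul_eq_mul,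
        ← mul_assoc, mul_inv_cancel₀ hL.pos.ne', one_mul]
      simp
    rw [h1, h2]
    refine mul_le_mul_of_nonneg_left ?_ hL.pos.le
    refine intervalIntegral.integral_mono_on zero_le_one ?_ ?_ fun s hs => hgh _ _ ?_
    · exact Continuous.intervalIntegrable (by fun_prop) _ _
    · exact Continuous.intervalIntegrable (by fun_prop) _ _
    · have e1 : torusFlow ξ (t₀ + L * s) = torusFlow ξ t₀ + torusFlow ξ (L * s) := torusFlow_add ..
      have e2 : y + torusFlow M (s + s₀) = (y + torusFlow M s₀) + torusFlow M s := by
        rw [torusFlow_add]; abel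
      have e3 : dist (torusFlow ξ t₀) (y + torusFlow M s₀) ≤ 1 / |(m 0 : ℝ)| := by
        rw [dist_eq_norm] at hs₀ ⊢
        rwa [← sub_sub]
      rw [e1, e2]
      calc _ ≤ _ := dist_add_add_le _ _ _ _
        _ ≤ 1 / |(m 0 : ℝ)| + 1 / |(m 0 : ℝ)| := add_le_add e3 (hL.dist_torusFlow_le hs)
        _ = _ := by ring
  -- The right-hand side of `hkey` does not depend on y, so integrating over y turns the left-hand
  -- side into the space average.
  rw [← integral_integral_torusFlow M hh, ← integral_const_mul]
  calc _ ≤ ∫ _ : UnitAddTorus (Fin 2), ∫ t in t₀..t₀ + L, g (torusFlow ξ t) := by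
        refine integral_mono (Continuous.integrable_of_hasCompactSupport ?_
          (HasCompactSupport.of_compactSpace _)) (integrable_const _) hkey
        exact continuous_const.mul
          (intervalIntegral.continuous_parametric_intervalIntegral_of_continuous' (by fun_prop) _ _)
    _ = _ := by simp

/-- Iterating `IsAlmostPeriod.mul_integral_le` over successive almost periods. -/
theorem IsAlmostPeriod.nat_mul_integral_le {ξ : Fin 2 → ℝ} {m : Fin 2 → ℤ} {L : ℝ}
    (hL : IsAlmostPeriod ξ m L) {g h : UnitAddTorus (Fin 2) → ℝ} (hg : Continuous g)
    (hh : Continuous h) (hgh : ∀ x y, dist x y ≤ 2 / |(m 0 : ℝ)| → h y ≤ g x) (k : ℕ) :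
    (k * L) * ∫ y, h y ≤ ∫ t in (0 : ℝ)..k * L, g (torusFlow ξ t) := by
  have hc : Continuous fun t => g (torusFlow ξ t) := hg.comp (continuous_torusFlow ξ)
  induction k with
  | zero => simp
  | succ k ih =>
    have e : ((k + 1 : ℕ) : ℝ) * L = k * L + L := by push_cast; ring
    rw [e, ← intervalIntegral.integral_add_adjacent_intervals
      (hc.intervalIntegrable 0 (k * L)) (hc.intervalIntegrable _ _), add_mul]
    exact add_le_add ih (hL.mul_integral_le hg hh hgh _)

theorem IsAlmostPeriod.half_mul_integral_le {ξ : Fin 2 → ℝ} {m : Fin 2 → ℤ} {L : ℝ}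
    (hL : IsAlmostPeriod ξ m L) {g h : UnitAddTorus (Fin 2) → ℝ} (hg : Continuous g)
    (hh : Continuous h) (hgh : ∀ x y, dist x y ≤ 2 / |(m 0 : ℝ)| → h y ≤ g x)
    (hg0 : ∀ x, 0 ≤ g x) (hh0 : ∀ x, 0 ≤ h x) {T : ℝ} (hT : L ≤ T) :
    T / 2 * ∫ y, h y ≤ ∫ t in (0 : ℝ)..T, g (torusFlow ξ t) := by
  have hc : Continuous fun t => g (torusFlow ξ t) := hg.comp (continuous_torusFlow ξ)
  have hLpos := hL.pos
  have h1 : (⌊T / L⌋₊ : ℝ) * L ≤ T := by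
    rw [← le_div_iff₀ hLpos]; exact Nat.floor_le (div_nonneg (hLpos.le.trans hT) hLpos.le)
  have h2 : T < (⌊T / L⌋₊ + 1 : ℝ) * L := by
    rw [← div_lt_iff₀ hLpos]; exact Nat.lt_floor_add_one _
  have h3 : (1 : ℝ) ≤ ⌊T / L⌋₊ := by
    exact_mod_cast Nat.le_floor (by rw [Nat.cast_one, le_div_iff₀ hLpos]; linarith)
  -- With k = ⌊T / L⌋₊ ≥ 1, T < (k + 1) L ≤ 2 k L.
  have h4 : T / 2 ≤ ⌊T / L⌋₊ * L := by nlinarith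
  calc _ ≤ (⌊T / L⌋₊ * L) * ∫ y, h y :=
        mul_le_mul_of_nonneg_right h4 (integral_nonneg hh0)
    _ ≤ _ := hL.nat_mul_integral_le hg hh hgh _
    _ ≤ _ := by
      rw [← intervalIntegral.integral_add_adjacent_intervals
        (hc.intervalIntegrable 0 (⌊T / L⌋₊ * L)) (hc.intervalIntegrable _ T)]
      exact le_add_of_nonneg_right (intervalIntegral.integral_nonneg h1 fun _ _ => hg0 _)

/-- Equidistribution of Lipschitz functions along the flow. -/
theorem IsAlmostPeriod.abs_integral_sub_le {ξ : Fin 2 → ℝ} {m : Fin 2 → ℤ} {L : ℝ}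
    (hL : IsAlmostPeriod ξ m L) {g : UnitAddTorus (Fin 2) → ℝ} (hg : Continuous g) {K B : ℝ}
    (hK : ∀ x y, g x ≤ g y + K * dist x y) (hK0 : 0 ≤ K)
    (hg0 : ∀ x, 0 ≤ g x) (hB : ∀ x, g x ≤ B) {T : ℝ} (hT : 0 ≤ T) :
    |(∫ t in (0 : ℝ)..T, g (torusFlow ξ t)) - T * ∫ y, g y| ≤ 2 * K * T / |(m 0 : ℝ)| + L * B := by
  have hc : Continuous fun t => g (torusFlow ξ t) := hg.comp (continuous_torusFlow ξ)
  have hLpos := hL.pos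
  have hint : Integrable g := Integrable.of_bound hg.aestronglyMeasurable B
    (Filter.Eventually.of_forall fun x => by rw [Real.norm_of_nonneg (hg0 x)]; exact hB x)
  have hI0 : 0 ≤ ∫ y, g y := integral_nonneg hg0
  have hIB : ∫ y, g y ≤ B := by
    calc _ ≤ ∫ _ : UnitAddTorus (Fin 2), B := integral_mono hint (integrable_const _) hB
      _ = B := by simp
  set k := ⌊T / L⌋₊ with hk
  have h1 : (k : ℝ) * L ≤ T := by
    rw [← le_div_iff₀ hLpos]; exact Nat.floor_le (by positivity)
  have h2 : T < (k + 1 : ℝ) * L := by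
    rw [← div_lt_iff₀ hLpos]; exact Nat.lt_floor_add_one _
  set e := 2 * K / |(m 0 : ℝ)| with he
  have he0 : 0 ≤ e := by positivity
  have hlow := hL.nat_mul_integral_le hg (h := fun y => g y - e) (by fun_prop) (fun x y hxy => by
    have := hK y x
    rw [dist_comm] at this
    have h3 : K * dist x y ≤ K * (2 / |(m 0 : ℝ)|) := by gcongr
    have h4 : K * (2 / |(m 0 : ℝ)|) = e := by rw [he]; ring
    linarith) k
  -- The upper bound is the lower bound for -g.
  have hup := hL.nat_mul_integral_le (g := fun y => - g y) (h := fun y => - g y - e) (by fun_prop)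
    (by fun_prop) (fun x y hxy => by
    have := hK x y
    have h3 : K * dist x y ≤ K * (2 / |(m 0 : ℝ)|) := by gcongr
    have h4 : K * (2 / |(m 0 : ℝ)|) = e := by rw [he]; ring
    linarith) k
  rw [integral_sub hint (integrable_const _)] at hlow
  rw [integral_sub hint.fun_neg (integrable_const _), integral_neg, intervalIntegral.integral_neg] at hup
  simp only [integral_const, probReal_univ, smul_eq_mul, one_mul] at hlow hup
  rw [← intervalIntegral.integral_add_adjacent_intervals
        (hc.intervalIntegrable 0 (k * L)) (hc.intervalIntegrable _ T)]
  have hr0 : 0 ≤ ∫ t in (k * L)..T, g (torusFlow ξ t) :=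
    intervalIntegral.integral_nonneg h1 fun _ _ => hg0 _
  have hr1 : ∫ t in (k * L)..T, g (torusFlow ξ t) ≤ (T - k * L) * B := by
    calc _ ≤ ∫ t in (k * L)..T, B := intervalIntegral.integral_mono_on h1
          (hc.intervalIntegrable _ _) (by simp) fun _ _ => hB _
      _ = _ := by simp
  have hB0 : 0 ≤ B := hI0.trans hIB
  have h5 : (T - k * L) * B ≤ L * B := by gcongr; linarith
  have h6 : (T - k * L) * ∫ y, g y ≤ (T - k * L) * B := by gcongr
  have h7 : 0 ≤ (T - k * L) * ∫ y, g y := mul_nonneg (by linarith) hI0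
  have h8 : k * L * e ≤ T * e := by gcongr
  have h9 : 2 * K * T / |(m 0 : ℝ)| = T * e := by rw [he]; ring
  rw [_root_.abs_le, h9]
  constructor <;> nlinarith

/-! ### Consequences of the Diophantine condition. -/

/-- A form with a bound R on the coordinates and a positive exponent; the Euclidean norm is at most
2R, hence the factor 2^(-σ). -/
theorem HasDiophantineIndex.exists_le_mul_rpow {ξ : Fin 2 → ℝ} {σ : ℝ}
    (h : HasDiophantineIndex ξ σ) :
    ∃ C : ℝ, 0 < C ∧ ∀ a b : ℤ, (a ≠ 0 ∨ b ≠ 0) → ∀ R : ℝ, |(a : ℝ)| ≤ R → |(b : ℝ)| ≤ R →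
      C ≤ |ξ 0 * a + ξ 1 * b| * R ^ σ := by
  obtain ⟨hσ, C, hC, h⟩ := h
  refine ⟨C * 2 ^ (-σ), by positivity, fun a b hab R ha hb => ?_⟩
  have h1 := h ![a, b] (by
    intro h0
    have h00 := congrFun h0 0
    have h01 := congrFun h0 1
    simp at h00 h01
    tauto)
  simp only [Fin.sum_univ_two, Matrix.cons_val_zero, Matrix.cons_val_one] at h1
  have hs : 0 < (a : ℝ) ^ 2 + (b : ℝ) ^ 2 := by
    rcases hab with h | h
    · have : (a : ℝ) ≠ 0 := by exact_mod_cast h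
      positivity
    · have : (b : ℝ) ≠ 0 := by exact_mod_cast h
      positivity
  have hR0 : 0 ≤ R := (abs_nonneg _).trans ha
  have hle : √((a : ℝ) ^ 2 + (b : ℝ) ^ 2) ≤ 2 * R := by
    rw [Real.sqrt_le_left (by positivity)]
    nlinarith [sq_le_sq' (abs_le.1 ha).1 (abs_le.1 ha).2, sq_le_sq' (abs_le.1 hb).1 (abs_le.1 hb).2,
      sq_nonneg R]
  have hRpos : 0 < R := by have := Real.sqrt_pos.2 hs; linarith
  have h2 : (2 * R) ^ (-σ) ≤ √((a : ℝ) ^ 2 + (b : ℝ) ^ 2) ^ (-σ) :=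
    Real.rpow_le_rpow_of_nonpos (Real.sqrt_pos.2 hs) hle (by linarith)
  rw [Real.mul_rpow (by norm_num) hR0] at h2
  have h3 : R ^ (-σ) * R ^ σ = 1 := by rw [← Real.rpow_add hRpos]; simp
  calc C * 2 ^ (-σ) = C * (2 ^ (-σ) * R ^ (-σ)) * R ^ σ := by
        linear_combination (-C * 2 ^ (-σ)) * h3
    _ ≤ _ := by
      gcongr
      exact (mul_le_mul_of_nonneg_left h2 hC.le).trans h1

theorem HasDiophantineIndex.mul_add_mul_ne_zero {ξ : Fin 2 → ℝ} {σ : ℝ}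
    (h : HasDiophantineIndex ξ σ) {a b : ℤ} (hab : a ≠ 0 ∨ b ≠ 0) : ξ 0 * a + ξ 1 * b ≠ 0 := by
  obtain ⟨C, hC, h⟩ := h.exists_le_mul_rpow
  intro h0
  have := h a b hab (max |(a : ℝ)| |(b : ℝ)|) (le_max_left _ _) (le_max_right _ _)
  rw [h0, abs_zero, zero_mul] at this
  linarith

theorem HasDiophantineIndex.apply_zero_ne_zero {ξ : Fin 2 → ℝ} {σ : ℝ}
    (h : HasDiophantineIndex ξ σ) : ξ 0 ≠ 0 := by
  simpa using h.mul_add_mul_ne_zero (a := 1) (b := 0) (by simp)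

theorem HasDiophantineIndex.mono {ξ : Fin 2 → ℝ} {σ σ' : ℝ}
    (h : HasDiophantineIndex ξ σ) (hσ : σ ≤ σ') : HasDiophantineIndex ξ σ' := by
  obtain ⟨h0, C, hC, h⟩ := h
  refine ⟨h0.trans_le hσ, C, hC, fun κ hκ => le_trans ?_ (h κ hκ)⟩
  refine mul_le_mul_of_nonneg_left ?_ hC.le
  refine Real.rpow_le_rpow_of_exponent_le ?_ (by linarith)
  rw [Real.one_le_sqrt]
  obtain ⟨i, hi⟩ := Function.ne_iff.1 hκ
  have h1 : (1 : ℝ) ≤ (κ i : ℝ) ^ 2 := by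
    have : 1 ≤ (κ i) ^ 2 := by
      have : 0 < (κ i) ^ 2 := by have : κ i ≠ 0 := hi
                                 positivity
      omega
    exact_mod_cast this
  exact h1.trans (Finset.single_le_sum (f := fun i => (κ i : ℝ) ^ 2) (fun _ _ => sq_nonneg _)
    (Finset.mem_univ i))

/-- Dirichlet's theorem, with the lower bound on denominators that a Diophantine index gives. -/
theorem HasDiophantineIndex.exists_isAlmostPeriod {ξ : Fin 2 → ℝ} {σ : ℝ}
    (h : HasDiophantineIndex ξ σ) :
    ∃ c : ℝ, 0 < c ∧ ∀ n : ℕ, 0 < n → ∃ (m : Fin 2 → ℤ) (L : ℝ), IsAlmostPeriod ξ m L ∧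
      L = |(m 0 : ℝ)| / |ξ 0| ∧ |(m 0 : ℝ)| ≤ n ∧ c * n ≤ |(m 0 : ℝ)| ^ σ := by
  have hσ := h.1
  have hξ0 := h.apply_zero_ne_zero
  obtain ⟨C, hC, hdio⟩ := h.exists_le_mul_rpow
  have hpos : 0 < |ξ 0| := abs_pos.2 hξ0
  set α := ξ 1 / |ξ 0| with hα
  refine ⟨C / (|ξ 0| * (|α| + 2) ^ σ), by positivity, fun n hn => ?_⟩
  obtain ⟨r, hr, hrn⟩ := Real.exists_rat_abs_sub_le_and_den_le α hn
  have hden : (0 : ℝ) < r.den := by exact_mod_cast r.den_pos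
  have hden1 : (1 : ℝ) ≤ r.den := by exact_mod_cast r.den_pos
  have hn0 : (0 : ℝ) < n := by exact_mod_cast hn
  have hrn' : (r.den : ℝ) ≤ n := by exact_mod_cast hrn
  have happ : |r.den * α - r.num| ≤ 1 / (n + 1) := by
    have e : (r.den : ℝ) * α - r.num = r.den * (α - r) := by
      conv_rhs => rw [Rat.cast_def]
      field_simp
    rw [e, abs_mul, abs_of_pos hden]
    calc _ ≤ (r.den : ℝ) * (1 / ((n + 1) * r.den)) := by gcongr
      _ = _ := by field_simp
  -- The sign of ξ 0 goes into the integer vector, so that L is positive.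
  obtain ⟨ε, hε, hεξ⟩ : ∃ ε : ℤ, (ε = 1 ∨ ε = -1) ∧ (ε : ℝ) * |ξ 0| = ξ 0 := by
    rcases abs_choice (ξ 0) with h | h
    · exact ⟨1, Or.inl rfl, by rw [h]; simp⟩
    · exact ⟨-1, Or.inr rfl, by rw [h]; simp⟩
  have hεabs : |(ε : ℝ)| = 1 := by rcases hε with rfl | rfl <;> norm_num
  have hm0 : |((ε * r.den : ℤ) : ℝ)| = r.den := by
    push_cast
    rw [abs_mul, hεabs, one_mul, abs_of_pos hden]
  refine ⟨![ε * r.den, r.num], r.den / |ξ 0|, ?_, ?_, ?_, ?_⟩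
  · refine ⟨by positivity, ?_, ?_, ?_, ?_⟩
    · change IsCoprime (ε * r.den) r.num
      have h1 : IsCoprime (r.den : ℤ) r.num := by
        rw [Int.isCoprime_iff_nat_coprime]
        simpa using r.reduced.symm
      rcases hε with rfl | rfl
      · simpa using h1
      · simpa using h1.neg_left
    · change ε * (r.den : ℤ) ≠ 0
      rcases hε with rfl | rfl <;> simp
    · simp only [Matrix.cons_val_zero]
      push_cast
      calc (r.den : ℝ) / |ξ 0| * ξ 0 = r.den / |ξ 0| * (ε * |ξ 0|) := by rw [hεξ]
        _ = _ := by field_simp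
    · simp only [Matrix.cons_val_zero, Matrix.cons_val_one]
      rw [hm0]
      have e : (r.den : ℝ) / |ξ 0| * ξ 1 = r.den * α := by rw [hα]; ring
      rw [e]
      refine happ.trans ?_
      gcongr
      linarith
  · simp only [Matrix.cons_val_zero]
    rw [hm0]
  · simp only [Matrix.cons_val_zero]
    rw [hm0]
    exact hrn'
  · simp only [Matrix.cons_val_zero]
    rw [hm0]
    have hR : |(r.num : ℝ)| ≤ r.den * (|α| + 2) := by
      have h1 : |(r.num : ℝ)| ≤ |r.den * α - r.num| + |r.den * α| := by
        rw [abs_sub_comm]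
        simpa using abs_add_le ((r.num : ℝ) - r.den * α) (r.den * α)
      have h2 : 1 / ((n : ℝ) + 1) ≤ 1 := by rw [div_le_one (by positivity)]; linarith
      rw [abs_mul, abs_of_pos hden] at h1
      nlinarith
    -- For this vector the Diophantine form has absolute value |ξ 0| |den α - num| ≤ |ξ 0| / n, so a
    -- denominator too small for n would violate the lower bound.
    have h1 := hdio r.num (-(ε * r.den)) (Or.inr (by rcases hε with rfl | rfl <;> simp))
      (r.den * (|α| + 2)) hR (by
        rw [Int.cast_neg, abs_neg, hm0]
        nlinarith [abs_nonneg α])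
    have e : ξ 0 * r.num + ξ 1 * ((-(ε * r.den) : ℤ) : ℝ)
        = -(ε * |ξ 0|) * (r.den * α - r.num) := by
      have hα' : α * |ξ 0| = ξ 1 := by rw [hα]; field_simp
      push_cast
      linear_combination (-r.num : ℝ) * hεξ + (ε * r.den : ℝ) * hα'
    rw [e, abs_mul, abs_neg, hεξ, Real.mul_rpow hden.le (by positivity)] at h1
    have h2 : |ξ 0| * |r.den * α - r.num| ≤ |ξ 0| * (1 / n) := by
      gcongr
      refine happ.trans ?_
      gcongr
      linarith
    have h3 : C ≤ |ξ 0| * (1 / n) * ((r.den : ℝ) ^ σ * (|α| + 2) ^ σ) :=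
      h1.trans (mul_le_mul_of_nonneg_right h2 (by positivity))
    rw [div_mul_eq_mul_div, div_le_iff₀ (by positivity)]
    calc C * n ≤ |ξ 0| * (1 / n) * ((r.den : ℝ) ^ σ * (|α| + 2) ^ σ) * n := by gcongr
      _ = _ := by field_simp

/-- Near returns of the flow to its starting point take a long time. -/
theorem HasDiophantineIndex.exists_le_mul_abs {ξ : Fin 2 → ℝ} (h : HasDiophantineIndex ξ 1) :
    ∃ c : ℝ, 0 < c ∧ ∀ (k : Fin 2 → ℤ) (t ρ : ℝ), k ≠ 0 → 0 ≤ ρ → ρ ≤ c →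
      (∀ i, |ξ i * t - k i| ≤ ρ) → c ≤ ρ * |t| := by
  have hξ0 := abs_pos.2 h.apply_zero_ne_zero
  obtain ⟨C, hC, hdio⟩ := h.exists_le_mul_rpow
  set S := |ξ 0| + |ξ 1| with hS
  have hS0 : 0 < S := by positivity
  set c₁ := C / (S * (S + 1)) with hc₁
  have hc₁0 : 0 < c₁ := by positivity
  refine ⟨min 1 (c₁ / 2), by positivity, fun k t ρ hk hρ hρc hkt => ?_⟩
  have hρ1 : ρ ≤ 1 := hρc.trans (min_le_left _ _)
  have hρ2 : ρ ≤ c₁ / 2 := hρc.trans (min_le_right _ _)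
  have hSi : ∀ i, |ξ i| ≤ S := by
    intro i
    fin_cases i
    · exact le_add_of_nonneg_right (abs_nonneg _)
    · exact le_add_of_nonneg_left (abs_nonneg _)
  have hki : ∀ i, |(k i : ℝ)| ≤ S * |t| + 1 := by
    intro i
    have h1 : |(k i : ℝ)| ≤ |ξ i * t - k i| + |ξ i * t| := by
      rw [abs_sub_comm]
      simpa using abs_add_le ((k i : ℝ) - ξ i * t) (ξ i * t)
    rw [abs_mul] at h1
    have h2 : |ξ i| * |t| ≤ S * |t| := mul_le_mul_of_nonneg_right (hSi i) (abs_nonneg t)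
    linarith [hkt i]
  have hk' : k 1 ≠ 0 ∨ -k 0 ≠ 0 := by
    by_contra hcon
    push Not at hcon
    apply hk
    funext i
    fin_cases i
    · simpa using hcon.2
    · exact hcon.1
  have h1 := hdio (k 1) (-k 0) hk' (S * |t| + 1) (hki 1) (by
    rw [Int.cast_neg, abs_neg]; exact hki 0)
  rw [Real.rpow_one] at h1
  have h2 : |ξ 0 * (k 1) + ξ 1 * ((-k 0 : ℤ) : ℝ)| ≤ ρ * S := by
    -- Eliminating t between the two coordinates leaves an integer combination of ξ 0 and ξ 1 of
    -- size O(ρ).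
    have e : ξ 0 * (k 1) + ξ 1 * ((-k 0 : ℤ) : ℝ)
        = -(ξ 0 * (ξ 1 * t - k 1)) + ξ 1 * (ξ 0 * t - k 0) := by push_cast; ring
    rw [e]
    refine (abs_add_le _ _).trans ?_
    rw [abs_neg, abs_mul, abs_mul, hS]
    have := mul_le_mul_of_nonneg_left (hkt 1) (abs_nonneg (ξ 0))
    have := mul_le_mul_of_nonneg_left (hkt 0) (abs_nonneg (ξ 1))
    linarith
  have h3 : C ≤ ρ * S * (S * |t| + 1) := h1.trans (mul_le_mul_of_nonneg_right h2 (by positivity))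
  have h4 : S * |t| + 1 ≤ (S + 1) * (|t| + 1) := by nlinarith [abs_nonneg t]
  have h5 : C ≤ ρ * S * ((S + 1) * (|t| + 1)) :=
    h3.trans (mul_le_mul_of_nonneg_left h4 (by positivity))
  have h6 : c₁ ≤ ρ * (|t| + 1) := by
    rw [hc₁, div_le_iff₀ (by positivity)]
    linarith
  -- Since ρ ≤ c₁ / 2, the 1 in ρ * (|t| + 1) costs at most half of c₁.
  have : min 1 (c₁ / 2) ≤ c₁ / 2 := min_le_right _ _
  linarith

/-! ### Visits of the orbit to the singular point. -/

theorem exists_abs_sub_le_of_dist_singularPoint_le {ξ : Fin 2 → ℝ} {t r : ℝ}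
    (h : dist (torusFlow ξ t) singularPoint ≤ r) :
    ∃ k : Fin 2 → ℤ, ∀ i, |ξ i * t - 1 / 4 - k i| ≤ r := by
  refine ⟨fun i => round (ξ i * t - 1 / 4), fun i => ?_⟩
  rw [← UnitAddCircle.norm_eq, AddCircle.coe_sub, ← dist_eq_norm]
  exact (dist_le_pi_dist (torusFlow ξ t) singularPoint i).trans h

/-- Hitting the zero would give ξ 0 (1 + 4 k 1) = ξ 1 (1 + 4 k 0), a resonance with odd, hence
nonzero, coefficients. -/
theorem HasDiophantineIndex.singularDist_torusFlow_pos {ξ : Fin 2 → ℝ} {σ : ℝ}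
    (h : HasDiophantineIndex ξ σ) (t : ℝ) : 0 < singularDist (torusFlow ξ t) := by
  by_contra hcon
  obtain ⟨k, hk⟩ := exists_abs_sub_le_of_dist_singularPoint_le
    ((dist_singularPoint_le _).trans (not_lt.1 hcon))
  have h0 := abs_nonpos_iff.1 (hk 0)
  have h1 := abs_nonpos_iff.1 (hk 1)
  refine h.mul_add_mul_ne_zero (a := 1 + 4 * k 1) (b := -(1 + 4 * k 0)) (Or.inl (by omega)) ?_
  push_cast
  linear_combination (-4 * ξ 0) * h1 + (4 * ξ 1) * h0

/-- A flow of Diophantine index `1` spends a time `O(T r²)` in the `r`-ball of the singular point. -/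
theorem HasDiophantineIndex.exists_volume_visits_le {ξ : Fin 2 → ℝ} (h : HasDiophantineIndex ξ 1) :
    ∃ C : ℝ, 0 < C ∧ ∀ T r : ℝ, 0 < T → 0 < r →
      volume ({t | singularDist (torusFlow ξ t) ≤ r} ∩ Set.Ioc 0 T)
        ≤ ENNReal.ofReal (C * T * r ^ 2) := by
  have hξ0 := abs_pos.2 h.apply_zero_ne_zero
  obtain ⟨c, hc, hret⟩ := h.exists_le_mul_abs
  refine ⟨max (16 / c ^ 2) (80 / (c * |ξ 0|)), by positivity, fun T r hT hr => ?_⟩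
  -- For r bounded below the trivial bound T is already O(T r²).
  rcases lt_or_ge c (4 * r) with hcr | hcr
  · calc _ ≤ volume (Set.Ioc 0 T) := measure_mono Set.inter_subset_right
      _ = ENNReal.ofReal T := by simp
      _ ≤ _ := by
        refine ENNReal.ofReal_le_ofReal ?_
        calc T = (1 / c ^ 2) * T * c ^ 2 := by field_simp
          _ ≤ (1 / c ^ 2) * T * (4 * r) ^ 2 := by gcongr
          _ = 16 / c ^ 2 * T * r ^ 2 := by ring
          _ ≤ _ := by gcongr; exact le_max_left _ _
  -- Four times (1/4, 1/4) is a lattice point, so a visit at time t is a near return to the origin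
  -- at time 4t, along the nonzero vector 1 + 4k.
  have hlate : ∀ t, singularDist (torusFlow ξ t) ≤ r → c ≤ 16 * r * |t| := by
    intro t ht
    obtain ⟨k, hk⟩ := exists_abs_sub_le_of_dist_singularPoint_le
      ((dist_singularPoint_le _).trans ht)
    have := hret (fun i => 1 + 4 * k i) (4 * t) (4 * r) (fun h0 => by
      have := congrFun h0 0
      simp only [Pi.zero_apply] at this
      omega) (by positivity) hcr fun i => by
        have e : ξ i * (4 * t) - ((1 + 4 * k i : ℤ) : ℝ) = 4 * (ξ i * t - 1 / 4 - k i) := by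
          push_cast; ring
        rw [e, abs_mul, abs_of_pos (by norm_num : (0 : ℝ) < 4)]
        linarith [hk i]
    rw [abs_mul, abs_of_pos (by norm_num : (0 : ℝ) < 4)] at this
    linarith
  -- Two visits with the same lattice vector belong to one short passage; with different vectors
  -- they form a near return and are far apart in time.
  have hsep : ∀ t t', singularDist (torusFlow ξ t) ≤ r → singularDist (torusFlow ξ t') ≤ r →
      |t' - t| < c / (2 * r) → |t' - t| ≤ 2 * r / |ξ 0| := by
    intro t t' ht ht' hlt
    obtain ⟨k, hk⟩ := exists_abs_sub_le_of_dist_singularPoint_le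
      ((dist_singularPoint_le _).trans ht)
    obtain ⟨k', hk'⟩ := exists_abs_sub_le_of_dist_singularPoint_le
      ((dist_singularPoint_le _).trans ht')
    have hd : ∀ i, |ξ i * (t' - t) - ((k' - k) i : ℤ)| ≤ 2 * r := by
      intro i
      have e : ξ i * (t' - t) - ((k' - k) i : ℤ)
          = (ξ i * t' - 1 / 4 - k' i) - (ξ i * t - 1 / 4 - k i) := by
        simp only [Pi.sub_apply]
        push_cast
        ring
      rw [e]
      refine (abs_sub _ _).trans ?_
      linarith [hk i, hk' i]
    by_cases h0 : k' - k = 0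
    · have := hd 0
      rw [h0] at this
      simp only [Pi.zero_apply, Int.cast_zero, sub_zero, abs_mul] at this
      rw [le_div_iff₀ hξ0]
      linarith
    · have := hret (k' - k) (t' - t) (2 * r) h0 (by positivity) (by linarith) hd
      rw [lt_div_iff₀ (by positivity)] at hlt
      linarith
  rcases lt_or_ge (16 * r * T) c with hTc | hTc
  · have : {t | singularDist (torusFlow ξ t) ≤ r} ∩ Set.Ioc 0 T = ∅ := by
      ext t
      simp only [Set.mem_inter_iff, Set.mem_ofPred_eq, Set.mem_Ioc, Set.mem_empty_iff_false, iff_false]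
      rintro ⟨h1, h2, h3⟩
      have h4 := hlate t h1
      rw [abs_of_pos h2] at h4
      have : 16 * r * t ≤ 16 * r * T := by gcongr
      linarith
    rw [this, measure_empty]
    exact zero_le
  -- Windows of half the return gap contain at most one passage, of length O(r), and there are O(rT)
  -- windows. The final + 1 in N is absorbed since 16 r T ≥ c: shorter times see no visit at all.
  set l := c / (4 * r) with hl
  have hl0 : 0 < l := by positivity
  set N := ⌊T / l⌋₊ + 1 with hN
  have hcover : {t | singularDist (torusFlow ξ t) ≤ r} ∩ Set.Ioc 0 T ⊆
      ⋃ k ∈ Finset.range N, {t | singularDist (torusFlow ξ t) ≤ r ∧ t ∈ Set.Ico (k * l) (k * l + l)} := by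
    rintro t ⟨h1, h2, h3⟩
    simp only [Set.mem_iUnion, Finset.mem_range]
    refine ⟨⌊t / l⌋₊, ?_, h1, ?_, ?_⟩
    · rw [hN, Nat.lt_succ_iff]
      gcongr
    · rw [← le_div_iff₀ hl0]; exact Nat.floor_le (by positivity)
    · have := Nat.lt_floor_add_one (t / l)
      rw [div_lt_iff₀ hl0] at this
      linarith
  have hpiece : ∀ k : ℕ, volume {t | singularDist (torusFlow ξ t) ≤ r ∧ t ∈ Set.Ico (k * l) (k * l + l)}
      ≤ ENNReal.ofReal (4 * r / |ξ 0|) := by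
    intro k
    rcases Set.eq_empty_or_nonempty
      {t | singularDist (torusFlow ξ t) ≤ r ∧ t ∈ Set.Ico (k * l) (k * l + l)} with he | ⟨t, ht, ht'⟩
    · rw [he, measure_empty]; exact zero_le
    · calc _ ≤ volume (Metric.closedBall t (2 * r / |ξ 0|)) := by
            refine measure_mono fun t' h' => ?_
            rw [Metric.mem_closedBall, Real.dist_eq]
            refine hsep t t' ht h'.1 ?_
            have : c / (2 * r) = 2 * l := by rw [hl]; field_simp; norm_num
            rw [this, abs_lt]
            constructor <;> linarith [ht'.1, ht'.2, h'.2.1, h'.2.2]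
        _ = _ := by rw [Real.volume_closedBall]; congr 1; ring
  calc _ ≤ _ := measure_mono hcover
    _ ≤ _ := measure_biUnion_finset_le _ _
    _ ≤ ∑ _k ∈ Finset.range N, ENNReal.ofReal (4 * r / |ξ 0|) := Finset.sum_le_sum fun k _ => hpiece k
    _ = ENNReal.ofReal (N * (4 * r / |ξ 0|)) := by
      rw [Finset.sum_const, Finset.card_range, nsmul_eq_mul, ENNReal.ofReal_mul (by positivity),
        ENNReal.ofReal_natCast]
    _ ≤ _ := by
      refine ENNReal.ofReal_le_ofReal ?_
      have h1 : (N : ℝ) ≤ 20 * r * T / c := by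
        have h2 : (⌊T / l⌋₊ : ℝ) ≤ T / l := Nat.floor_le (by positivity)
        have h3 : T / l = 4 * r * T / c := by rw [hl]; field_simp
        have h4 : 1 ≤ 16 * r * T / c := by rw [le_div_iff₀ hc]; linarith
        have h5 : 20 * r * T / c = 4 * r * T / c + 16 * r * T / c := by ring
        rw [hN]
        push_cast
        linarith
      calc _ ≤ 20 * r * T / c * (4 * r / |ξ 0|) := by gcongr
        _ = 80 / (c * |ξ 0|) * T * r ^ 2 := by field_simp; norm_num
        _ ≤ _ := by gcongr; exact le_max_right _ _

/-! ### Integrals and truncations of negative powers. -/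

/-- If the sublevel sets of `D` have the measure of planar balls, then `D ^ (-γ)` with `γ < 2` has
a small integral near `D = 0`. -/
theorem setLIntegral_rpow_neg_le {X : Type*} [MeasurableSpace X] {μ : Measure X} {D : X → ℝ}
    (hD : Measurable D) (hD0 : ∀ x, 0 ≤ D x) {K γ δ : ℝ} (hK : 0 ≤ K) (hγ0 : 0 < γ) (hγ : γ < 2)
    (hδ : 0 < δ) (hμ : ∀ r, 0 < r → μ {x | D x ≤ r} ≤ ENNReal.ofReal (K * r ^ 2)) :
    ∫⁻ x in {x | D x ≤ δ}, ENNReal.ofReal (D x ^ (-γ)) ∂μ ≤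
      ENNReal.ofReal (K * (2 ^ γ / (1 - 2 ^ (γ - 2))) * δ ^ (2 - γ)) := by
  have hms : ∀ r, MeasurableSet {x | D x ≤ r} := fun r => measurableSet_le hD measurable_const
  -- Dyadic shells: where 2^(-j-1) δ < D ≤ 2^(-j) δ the integrand is at most v j, and A j has
  -- measure at most K 4^(-j) δ². The series is geometric of ratio 2^(γ-2).
  set A : ℕ → Set X := fun j => {x | D x ≤ (1 / 2) ^ j * δ} with hA
  set v : ℕ → ℝ := fun j => ((1 / 2) ^ (j + 1) * δ) ^ (-γ) with hv
  have hv0 : ∀ j, 0 ≤ v j := fun j => by positivity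
  have hpt : ∀ x, ({x | D x ≤ δ}).indicator (fun x => ENNReal.ofReal (D x ^ (-γ))) x ≤
      ∑' j, (A j).indicator (fun _ => ENNReal.ofReal (v j)) x := by
    intro x
    by_cases hx : D x ≤ δ
    · rw [Set.indicator_of_mem (by exact hx)]
      rcases (hD0 x).eq_or_lt with h0 | h0
      -- Points with D = 0 contribute nothing, because 0 ^ (-γ) is 0 by convention.
      · rw [← h0, Real.zero_rpow (by linarith), ENNReal.ofReal_zero]
        exact zero_le
      · obtain ⟨j, hj1, hj2⟩ := exists_nat_pow_near_of_lt_one (x := D x / δ) (y := (1 / 2 : ℝ))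
          (by positivity) ((div_le_one hδ).2 hx) (by norm_num) (by norm_num)
        rw [lt_div_iff₀ hδ] at hj1
        rw [div_le_iff₀ hδ] at hj2
        refine le_trans ?_ (ENNReal.le_tsum j)
        rw [Set.indicator_of_mem (by exact hj2)]
        exact ENNReal.ofReal_le_ofReal
          (Real.rpow_le_rpow_of_nonpos (by positivity) hj1.le (by linarith))
    · rw [Set.indicator_of_notMem (by exact hx)]
      exact zero_le
  have hρ0 : (0 : ℝ) < 2 ^ (γ - 2) := by positivity
  have hρ1 : (2 : ℝ) ^ (γ - 2) < 1 := Real.rpow_lt_one_of_one_lt_of_neg (by norm_num) (by linarith)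
  calc _ = ∫⁻ x, ({x | D x ≤ δ}).indicator (fun x => ENNReal.ofReal (D x ^ (-γ))) x ∂μ :=
        (lintegral_indicator (hms δ) _).symm
    _ ≤ ∫⁻ x, ∑' j, (A j).indicator (fun _ => ENNReal.ofReal (v j)) x ∂μ := lintegral_mono hpt
    _ = ∑' j, ENNReal.ofReal (v j) * μ (A j) := by
      rw [lintegral_tsum fun j => (measurable_const.indicator (hms _)).aemeasurable]
      congr 1 with j
      rw [lintegral_indicator_const (hms _)]
    _ ≤ ∑' j, ENNReal.ofReal (K * 2 ^ γ * δ ^ (2 - γ) * (2 ^ (γ - 2)) ^ j) := by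
      refine ENNReal.tsum_le_tsum fun j => ?_
      calc _ ≤ ENNReal.ofReal (v j) * ENNReal.ofReal (K * ((1 / 2) ^ j * δ) ^ 2) := by
            gcongr
            exact hμ _ (by positivity)
        _ = _ := by
          rw [← ENNReal.ofReal_mul (hv0 j)]
          congr 1
          have e1 : (((1 : ℝ) / 2) ^ (j + 1) * δ) = (1 / 2) * ((1 / 2) ^ j * δ) := by ring
          have e2 : ((1 / 2 : ℝ)) ^ (-γ) = 2 ^ γ := by
            rw [one_div, Real.inv_rpow (by norm_num), Real.rpow_neg (by norm_num), inv_inv]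
          have e3 : ∀ s : ℝ, 0 < s → s ^ (-γ) * s ^ 2 = s ^ (2 - γ) := by
            intro s hs
            rw [← Real.rpow_two, ← Real.rpow_add hs]
            congr 1; ring
          have e4 : ((1 / 2 : ℝ) ^ j) ^ (2 - γ) = (2 ^ (γ - 2)) ^ j := by
            rw [← Real.rpow_natCast, ← Real.rpow_mul (by norm_num), mul_comm,
              Real.rpow_mul (by norm_num), Real.rpow_natCast, one_div, Real.inv_rpow (by norm_num),
              ← Real.rpow_neg (by norm_num), neg_sub]
          rw [hv]
          simp only
          rw [e1, Real.mul_rpow (by norm_num) (by positivity), e2]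
          calc _ = K * 2 ^ γ * (((1 / 2) ^ j * δ) ^ (-γ) * ((1 / 2) ^ j * δ) ^ 2) := by ring
            _ = _ := by
              rw [e3 _ (by positivity), Real.mul_rpow (by positivity) hδ.le, e4]
              ring
    _ = _ := by
      rw [← ENNReal.ofReal_tsum_of_nonneg (fun j => by positivity)
        ((summable_geometric_of_lt_one hρ0.le hρ1).mul_left _), tsum_mul_left,
        tsum_geometric_of_lt_one hρ0.le hρ1]
      congr 1
      ring

theorem integrable_rpow_neg {X : Type*} [MeasurableSpace X] {μ : Measure X} {D : X → ℝ}
    (hD : Measurable D) (hD0 : ∀ x, 0 ≤ D x) {K γ R : ℝ} (hK : 0 ≤ K) (hγ0 : 0 < γ) (hγ : γ < 2)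
    (hR : 0 < R) (hDR : ∀ x, D x ≤ R)
    (hμ : ∀ r, 0 < r → μ {x | D x ≤ r} ≤ ENNReal.ofReal (K * r ^ 2)) :
    Integrable (fun x => D x ^ (-γ)) μ := by
  refine ⟨(hD.pow_const _).aestronglyMeasurable, ?_⟩
  rw [hasFiniteIntegral_iff_ofReal (Filter.Eventually.of_forall fun x => Real.rpow_nonneg (hD0 x) _)]
  have h := setLIntegral_rpow_neg_le hD hD0 hK hγ0 hγ hR hμ
  have hu : {x | D x ≤ R} = Set.univ := Set.eq_univ_of_forall hDR
  rw [hu, setLIntegral_univ] at h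
  exact h.trans_lt ENNReal.ofReal_lt_top

/-- Stated for an abstract measure so as to serve both the torus and Lebesgue measure on (0, T],
where K is proportional to T. -/
theorem abs_integral_rpow_neg_sub_le {X : Type*} [MeasurableSpace X] {μ : Measure X}
    {D : X → ℝ}
    (hD : Measurable D) (hD0 : ∀ x, 0 ≤ D x) {K γ δ R : ℝ} (hK : 0 ≤ K) (hγ0 : 0 < γ) (hγ : γ < 2)
    (hδ : 0 < δ) (hR : 0 < R) (hDR : ∀ x, D x ≤ R)
    (hμ : ∀ r, 0 < r → μ {x | D x ≤ r} ≤ ENNReal.ofReal (K * r ^ 2)) :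
    |(∫ x, D x ^ (-γ) ∂μ) - ∫ x, max (D x) δ ^ (-γ) ∂μ| ≤
      K * (2 ^ γ / (1 - 2 ^ (γ - 2)) + 1) * δ ^ (2 - γ) := by
  have hms : ∀ r, MeasurableSet {x | D x ≤ r} := fun r => measurableSet_le hD measurable_const
  have hfin : IsFiniteMeasure μ := by
    refine ⟨?_⟩
    rw [← Set.eq_univ_of_forall (s := {x | D x ≤ R}) hDR]
    exact (hμ R hR).trans_lt ENNReal.ofReal_lt_top
  have hf := integrable_rpow_neg hD hD0 hK hγ0 hγ hR hDR hμ
  have hmax : ∀ x, 0 ≤ max (D x) δ ^ (-γ) := fun x =>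
    Real.rpow_nonneg (hδ.le.trans (le_max_right _ _)) _
  have hmaxle : ∀ x, max (D x) δ ^ (-γ) ≤ δ ^ (-γ) := fun x =>
    Real.rpow_le_rpow_of_nonpos hδ (le_max_right _ _) (by linarith)
  have hg : Integrable (fun x => max (D x) δ ^ (-γ)) μ := by
    refine Integrable.of_bound ((hD.max measurable_const).pow_const _).aestronglyMeasurable
      (δ ^ (-γ)) (Filter.Eventually.of_forall fun x => ?_)
    rw [Real.norm_of_nonneg (hmax x)]
    exact hmaxle x
  have hρ1 : (2 : ℝ) ^ (γ - 2) < 1 := Real.rpow_lt_one_of_one_lt_of_neg (by norm_num) (by linarith)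
  have hB : 0 ≤ (2 : ℝ) ^ γ / (1 - 2 ^ (γ - 2)) := div_nonneg (by positivity) (by linarith)
  rw [← integral_sub hf hg, ← Real.norm_eq_abs]
  refine (ENNReal.ofReal_le_ofReal_iff (by positivity)).1 ?_
  rw [ofReal_norm]
  calc _ ≤ ∫⁻ x, ‖D x ^ (-γ) - max (D x) δ ^ (-γ)‖ₑ ∂μ := enorm_integral_le_lintegral_enorm _
    _ ≤ ∫⁻ x, ({x | D x ≤ δ}).indicator
          (fun x => ENNReal.ofReal (D x ^ (-γ)) + ENNReal.ofReal (δ ^ (-γ))) x ∂μ := by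
      refine lintegral_mono fun x => ?_
      by_cases hx : D x ≤ δ
      · rw [Set.indicator_of_mem (by exact hx), ← ofReal_norm,
          ← ENNReal.ofReal_add (Real.rpow_nonneg (hD0 x) _) (by positivity)]
        refine ENNReal.ofReal_le_ofReal ?_
        rw [Real.norm_eq_abs, abs_le]
        have := Real.rpow_nonneg (hD0 x) (-γ)
        constructor <;> linarith [hmax x, hmaxle x]
      · rw [Set.indicator_of_notMem (by exact hx), max_eq_left (not_le.1 hx).le]
        simp
    _ = (∫⁻ x in {x | D x ≤ δ}, ENNReal.ofReal (D x ^ (-γ)) ∂μ)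
          + ENNReal.ofReal (δ ^ (-γ)) * μ {x | D x ≤ δ} := by
      rw [lintegral_indicator (hms δ), lintegral_add_right _ measurable_const, setLIntegral_const]
    _ ≤ ENNReal.ofReal (K * (2 ^ γ / (1 - 2 ^ (γ - 2))) * δ ^ (2 - γ))
          + ENNReal.ofReal (δ ^ (-γ)) * ENNReal.ofReal (K * δ ^ 2) := by
      gcongr
      · exact setLIntegral_rpow_neg_le hD hD0 hK hγ0 hγ hδ hμ
      · exact hμ δ hδ
    _ = _ := by
      rw [← ENNReal.ofReal_mul (by positivity), ← ENNReal.ofReal_add (by positivity) (by positivity)]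
      congr 1
      have e : δ ^ (2 - γ) = δ ^ (-γ) * δ ^ 2 := by
        rw [← Real.rpow_two, ← Real.rpow_add hδ]
        congr 1; ring
      rw [e]
      ring

theorem rpow_neg_le_rpow_neg_add {a b δ γ : ℝ} (hδ : 0 < δ) (ha : δ ≤ a) (hb : δ ≤ b)
    (hγ : 0 < γ) : a ^ (-γ) ≤ b ^ (-γ) + γ * δ ^ (-γ - 1) * |a - b| := by
  have ha0 := hδ.trans_le ha
  have hb0 := hδ.trans_le hb
  rcases le_total b a with h | h
  · have := Real.rpow_le_rpow_of_nonpos hb0 h (by linarith : -γ ≤ 0)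
    have : 0 ≤ γ * δ ^ (-γ - 1) * |a - b| := by positivity
    linarith
  -- Bernoulli's inequality for a negative exponent, from log x ≤ x - 1 and 1 + y ≤ exp y.
  · have h1 : 1 - γ * (b / a - 1) ≤ (b / a) ^ (-γ) := by
      rw [Real.rpow_def_of_pos (by positivity)]
      have h2 := Real.log_le_sub_one_of_pos (show 0 < b / a by positivity)
      have h3 := Real.add_one_le_exp (Real.log (b / a) * -γ)
      nlinarith
    rw [Real.div_rpow hb0.le ha0.le, le_div_iff₀ (by positivity)] at h1
    have h4 : a ^ (-γ - 1) ≤ δ ^ (-γ - 1) := Real.rpow_le_rpow_of_nonpos hδ ha (by linarith)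
    have h5 : a ^ (-γ) * (b / a - 1) = a ^ (-γ - 1) * (b - a) := by
      rw [Real.rpow_sub_one ha0.ne']
      field_simp
    have h6 : a ^ (-γ - 1) * (b - a) ≤ δ ^ (-γ - 1) * (b - a) :=
      mul_le_mul_of_nonneg_right h4 (by linarith)
    rw [abs_of_nonpos (by linarith)]
    nlinarith

/-! ### Volumes near the zero and first properties of the averages. -/

theorem volume_closedBall_torus (x : UnitAddTorus (Fin 2)) {r : ℝ} (hr : 0 ≤ r) :
    volume (Metric.closedBall x r) = ENNReal.ofReal (min 1 (2 * r) ^ 2) := by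
  rw [closedBall_pi x hr, volume_pi_pi]
  simp only [AddCircle.volume_closedBall, Fin.prod_univ_two]
  rw [← ENNReal.ofReal_mul (by positivity), sq]

theorem volume_singularDist_le {r : ℝ} (hr : 0 < r) :
    volume {x | singularDist x ≤ r} ≤ ENNReal.ofReal (4 * r ^ 2) := by
  calc _ ≤ volume (Metric.closedBall singularPoint r) :=
        measure_mono fun x hx => (dist_singularPoint_le x).trans hx
    _ = _ := volume_closedBall_torus _ hr.le
    _ ≤ _ := by
      refine ENNReal.ofReal_le_ofReal ?_
      calc _ ≤ (2 * r) ^ 2 := by gcongr; exact min_le_right _ _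
        _ = _ := by ring

/-- The sup-metric ball of radius r / 10 lies in the sublevel set; r ≤ 5 keeps its side r / 5 from
wrapping around the torus. -/
theorem le_volume_real_singularDist_le {r : ℝ} (hr : 0 ≤ r) (hr5 : r ≤ 5) :
    (r / 5) ^ 2 ≤ volume.real {x | singularDist x ≤ r} := by
  calc (r / 5) ^ 2 = volume.real (Metric.closedBall singularPoint (r / 10)) := by
        rw [measureReal_def, volume_closedBall_torus _ (by positivity),
          ENNReal.toReal_ofReal (by positivity), min_eq_right (by linarith)]
        ring
    _ ≤ _ := measureReal_mono fun x hx => by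
        have h1 := singularDist_le x
        rw [Metric.mem_closedBall] at hx
        change singularDist x ≤ r
        linarith

theorem birkhoffMean_eq (γ : ℝ) (ξ : Fin 2 → ℝ) (T : ℝ) :
    birkhoffMean γ ξ T = (1 / T) * ∫ t in (0 : ℝ)..T, singularDist (torusFlow ξ t) ^ (-γ) := by
  simp only [birkhoffMean, one_div_sqrt_prototypeU]

theorem torusMean_eq (γ : ℝ) : torusMean γ = ∫ x, singularDist x ^ (-γ) := by
  simp only [torusMean, one_div_sqrt_prototypeU]

theorem HasDiophantineIndex.continuous_rpow_neg {ξ : Fin 2 → ℝ} {σ : ℝ}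
    (h : HasDiophantineIndex ξ σ) (γ : ℝ) :
    Continuous fun t => singularDist (torusFlow ξ t) ^ (-γ) :=
  (continuous_singularDist.comp (continuous_torusFlow ξ)).rpow_const
    fun t => Or.inl (h.singularDist_torusFlow_pos t).ne'

theorem HasDiophantineIndex.wellDefinedAlongFlow {ξ : Fin 2 → ℝ} {σ : ℝ}
    (h : HasDiophantineIndex ξ σ) (γ : ℝ) : WellDefinedAlongFlow γ ξ := by
  refine ⟨fun x => ?_, fun a b => ?_⟩
  · rw [prototypeU_eq]
    have := h.singularDist_torusFlow_pos x
    positivity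
  · simp only [one_div_sqrt_prototypeU]
    exact (h.continuous_rpow_neg γ).intervalIntegrable a b

theorem integrable_singularDist_rpow {γ : ℝ} (hγ0 : 0 < γ) (hγ : γ < 2) :
    Integrable fun x => singularDist x ^ (-γ) :=
  integrable_rpow_neg continuous_singularDist.measurable singularDist_nonneg (by norm_num) hγ0 hγ
    two_pos singularDist_le_two fun _ hr => volume_singularDist_le hr

theorem HasDiophantineIndex.le_birkhoffMean {ξ : Fin 2 → ℝ} {σ : ℝ}
    (h : HasDiophantineIndex ξ σ) {γ : ℝ} (hγ : 0 < γ) {T : ℝ} (hT : 0 < T) :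
    2 ^ (-γ) ≤ birkhoffMean γ ξ T := by
  rw [birkhoffMean_eq, one_div, ← div_eq_inv_mul, le_div_iff₀ hT]
  calc (2 : ℝ) ^ (-γ) * T = ∫ _ in (0 : ℝ)..T, (2 : ℝ) ^ (-γ) := by simp [mul_comm]
    _ ≤ _ := intervalIntegral.integral_mono_on hT.le (by simp)
      ((h.continuous_rpow_neg γ).intervalIntegrable _ _) fun t _ =>
        Real.rpow_le_rpow_of_nonpos (h.singularDist_torusFlow_pos t) (singularDist_le_two _)
          (by linarith)

theorem continuous_max_singularDist_rpow {δ : ℝ} (hδ : 0 < δ) (γ : ℝ) :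
    Continuous fun x => max (singularDist x) δ ^ (-γ) :=
  (continuous_singularDist.max continuous_const).rpow_const
    fun _ => Or.inl (hδ.trans_le (le_max_right _ _)).ne'

/-! ### Convergence for γ < 2. -/

/-- The rate of convergence for `γ < 2` at large times. -/
theorem HasDiophantineIndex.exists_abs_birkhoffMean_sub_le_of_one_le {ξ : Fin 2 → ℝ}
    (h : HasDiophantineIndex ξ 1) {γ : ℝ} (hγ0 : 0 < γ) (hγ : γ < 2) :
    ∃ C : ℝ, 0 < C ∧ ∀ T : ℝ, 1 ≤ T →
      |birkhoffMean γ ξ T - torusMean γ| ≤ C * T ^ (-((2 - γ) / 6)) := by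
  have hξ0 := abs_pos.2 h.apply_zero_ne_zero
  obtain ⟨C₁, hC₁, hvisit⟩ := h.exists_volume_visits_le
  obtain ⟨c, hc, hper⟩ := h.exists_isAlmostPeriod
  have hρ1 : (2 : ℝ) ^ (γ - 2) < 1 := Real.rpow_lt_one_of_one_lt_of_neg (by norm_num) (by linarith)
  set B := (2 : ℝ) ^ γ / (1 - 2 ^ (γ - 2)) + 1 with hBdef
  have hB : 0 < B := by
    have : 0 ≤ (2 : ℝ) ^ γ / (1 - 2 ^ (γ - 2)) := div_nonneg (by positivity) (by linarith)
    positivity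
  refine ⟨C₁ * B + (40 * γ / c + 1 / |ξ 0|) + 4 * B, by positivity, fun T hT => ?_⟩
  have hT0 : 0 < T := by linarith
  -- This δ solves δ^(2-γ) = T^(-1/2) δ^(-γ-1), whatever γ is.
  set δ := T ^ (-(1 / 6) : ℝ) with hδdef
  have hδ : 0 < δ := by positivity
  have hδ1 : δ ≤ 1 := Real.rpow_le_one_of_one_le_of_nonpos hT (by norm_num)
  have hδγ : δ ^ (2 - γ) = T ^ (-((2 - γ) / 6)) := by
    rw [hδdef, ← Real.rpow_mul hT0.le]
    congr 1; ring
  set g : UnitAddTorus (Fin 2) → ℝ := fun x => max (singularDist x) δ ^ (-γ) with hg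
  have hgc : Continuous g := continuous_max_singularDist_rpow hδ γ
  -- truncation errors
  have h1 : |(∫ x, singularDist x ^ (-γ)) - ∫ x, g x| ≤ 4 * B * δ ^ (2 - γ) :=
    abs_integral_rpow_neg_sub_le continuous_singularDist.measurable singularDist_nonneg
      (by norm_num) hγ0 hγ hδ two_pos singularDist_le_two fun _ hr => volume_singularDist_le hr
  have hwc : Continuous fun t => singularDist (torusFlow ξ t) :=
    continuous_singularDist.comp (continuous_torusFlow ξ)
  have h2 : |(∫ t in (0 : ℝ)..T, singularDist (torusFlow ξ t) ^ (-γ))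
      - ∫ t in (0 : ℝ)..T, g (torusFlow ξ t)| ≤ (C₁ * T) * B * δ ^ (2 - γ) := by
    rw [intervalIntegral.integral_of_le hT0.le, intervalIntegral.integral_of_le hT0.le]
    refine abs_integral_rpow_neg_sub_le hwc.measurable (fun _ => singularDist_nonneg _)
      (by positivity) hγ0 hγ hδ two_pos (fun _ => singularDist_le_two _) fun r hr => ?_
    rw [Measure.restrict_apply (measurableSet_le hwc.measurable measurable_const)]
    exact hvisit T r hT0 hr
  -- equidistribution of the truncation
  have hsqrt1 : 1 ≤ √T := by rwa [Real.one_le_sqrt]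
  have hn : 0 < ⌊√T⌋₊ := Nat.floor_pos.2 hsqrt1
  obtain ⟨m, L, hL, hLeq, hmn, hcn⟩ := hper ⌊√T⌋₊ hn
  rw [Real.rpow_one] at hcn
  have hq0 : 0 < |(m 0 : ℝ)| := abs_pos.2 (by exact_mod_cast hL.ne_zero)
  have hqle : |(m 0 : ℝ)| ≤ √T := hmn.trans (Nat.floor_le (by positivity))
  have hqge : c * √T / 2 ≤ |(m 0 : ℝ)| := by
    have h3 := Nat.lt_floor_add_one √T
    have h4 : (1 : ℝ) ≤ ⌊√T⌋₊ := by exact_mod_cast hn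
    have h5 : √T / 2 ≤ ⌊√T⌋₊ := by linarith
    have := mul_le_mul_of_nonneg_left h5 hc.le
    linarith
  have hLle : L ≤ √T / |ξ 0| := by rw [hLeq]; gcongr
  have hTs : √T * √T = T := Real.mul_self_sqrt hT0.le
  -- The supremum δ^(-γ) is weakened to δ^(-γ-1), using δ ≤ 1, so that both error terms have the
  -- same order √T δ^(-γ-1).
  have h3 := hL.abs_integral_sub_le hgc (K := 10 * γ * δ ^ (-γ - 1)) (B := δ ^ (-γ - 1))
    (fun x y => by
      refine (rpow_neg_le_rpow_neg_add hδ (le_max_right _ _) (le_max_right (singularDist y) _)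
        hγ0).trans ?_
      have h4 : |max (singularDist x) δ - max (singularDist y) δ| ≤ 10 * dist x y := by
        refine (abs_max_sub_max_le_abs _ _ _).trans ?_
        rw [abs_le]
        have := le_singularDist_add x y
        have := le_singularDist_add y x
        rw [dist_comm y x] at this
        constructor <;> linarith
      have := mul_le_mul_of_nonneg_left h4 (show 0 ≤ γ * δ ^ (-γ - 1) by positivity)
      linarith) (by positivity)
    (fun x => Real.rpow_nonneg (hδ.le.trans (le_max_right _ _)) _)
    (fun x => (Real.rpow_le_rpow_of_nonpos hδ (le_max_right _ _) (by linarith)).trans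
      (Real.rpow_le_rpow_of_exponent_ge hδ hδ1 (by linarith))) hT0.le
  have h4 : 2 * (10 * γ * δ ^ (-γ - 1)) * T / |(m 0 : ℝ)| + L * δ ^ (-γ - 1)
      ≤ (40 * γ / c + 1 / |ξ 0|) * (T * T ^ (-((2 - γ) / 6))) := by
    have e : T * T ^ (-((2 - γ) / 6)) = √T * δ ^ (-γ - 1) := by
      rw [hδdef, Real.sqrt_eq_rpow, ← Real.rpow_mul hT0.le, ← Real.rpow_one_add' hT0.le (by linarith),
        ← Real.rpow_add hT0]
      congr 1; ring
    rw [e, add_mul]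
    refine add_le_add ?_ ?_
    · calc _ ≤ 2 * (10 * γ * δ ^ (-γ - 1)) * T / (c * √T / 2) := by gcongr
        _ = 2 * (10 * γ * δ ^ (-γ - 1)) * (√T * √T) / (c * √T / 2) := by rw [hTs]
        _ = _ := by field_simp; norm_num
    · calc _ ≤ √T / |ξ 0| * δ ^ (-γ - 1) := by gcongr
        _ = _ := by ring
  have h5 := h3.trans h4
  rw [hδγ] at h1 h2
  set E := T ^ (-((2 - γ) / 6)) with hE
  have e : birkhoffMean γ ξ T - torusMean γ
      = (((∫ t in (0 : ℝ)..T, singularDist (torusFlow ξ t) ^ (-γ))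
          - ∫ t in (0 : ℝ)..T, g (torusFlow ξ t))
        + ((∫ t in (0 : ℝ)..T, g (torusFlow ξ t)) - T * ∫ x, g x)) / T
        - ((∫ x, singularDist x ^ (-γ)) - ∫ x, g x) := by
    rw [birkhoffMean_eq, torusMean_eq]
    field_simp
    ring
  rw [e]
  refine (abs_sub _ _).trans ?_
  have h6 := (abs_add_le ((∫ t in (0 : ℝ)..T, singularDist (torusFlow ξ t) ^ (-γ))
          - ∫ t in (0 : ℝ)..T, g (torusFlow ξ t))
        ((∫ t in (0 : ℝ)..T, g (torusFlow ξ t)) - T * ∫ x, g x)).trans (add_le_add h2 h5)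
  rw [abs_div, abs_of_pos hT0]
  calc _ ≤ (C₁ * T * B * E + (40 * γ / c + 1 / |ξ 0|) * (T * E)) / T + 4 * B * E := by gcongr
    _ = _ := by field_simp

/-- For T ≤ 1 the mean is bounded by continuity on [0, 1] and T^(-τ) ≥ 1; for T ≥ 1 the exponent may
be lowered to τ. -/
theorem HasDiophantineIndex.exists_abs_birkhoffMean_sub_le {ξ : Fin 2 → ℝ}
    (h : HasDiophantineIndex ξ 1) {γ τ : ℝ} (hγ0 : 0 < γ) (hγ : γ < 2) (hτ0 : 0 ≤ τ)
    (hτ : τ ≤ (2 - γ) / 6) :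
    ∃ C : ℝ, 0 < C ∧ ∀ T : ℝ, 0 < T →
      |birkhoffMean γ ξ T - torusMean γ| ≤ C * T ^ (-τ) := by
  obtain ⟨C, hC, hlarge⟩ := h.exists_abs_birkhoffMean_sub_le_of_one_le hγ0 hγ
  have hcont := h.continuous_rpow_neg γ
  obtain ⟨B, hB⟩ := (isCompact_Icc (a := (0 : ℝ)) (b := 1)).exists_bound_of_continuousOn
    hcont.continuousOn
  refine ⟨max C (B + |torusMean γ|), lt_max_of_lt_left hC, fun T hT => ?_⟩
  rcases le_total 1 T with h1 | h1
  · calc _ ≤ _ := hlarge T h1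
      _ ≤ C * T ^ (-τ) := by gcongr
      _ ≤ _ := by gcongr; exact le_max_left _ _
  · have h2 : |birkhoffMean γ ξ T| ≤ B := by
      rw [birkhoffMean_eq, abs_mul, abs_of_pos (by positivity), one_div, ← div_eq_inv_mul,
        div_le_iff₀ hT]
      have := intervalIntegral.norm_integral_le_of_norm_le_const (a := 0) (b := T) (C := B)
        (f := fun t => singularDist (torusFlow ξ t) ^ (-γ)) fun t ht => by
          rw [Set.uIoc_of_le hT.le] at ht
          exact hB t ⟨ht.1.le, ht.2.trans h1⟩
      rwa [sub_zero, abs_of_pos hT] at this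
    have h3 : 1 ≤ T ^ (-τ) := Real.one_le_rpow_of_pos_of_le_one_of_nonpos hT h1 (by linarith)
    have h4 : 0 ≤ B := (abs_nonneg _).trans h2
    calc _ ≤ |birkhoffMean γ ξ T| + |torusMean γ| := abs_sub _ _
      _ ≤ (B + |torusMean γ|) * 1 := by linarith
      _ ≤ _ := by gcongr; exact le_max_right _ _

/-! ### Lower bounds for γ ≥ 2. -/

/-- Time averages dominate space averages of a regularised potential, at a scale `1 / q` which the
Diophantine index controls. -/
theorem HasDiophantineIndex.exists_half_integral_le_birkhoffMean {ξ : Fin 2 → ℝ} {σ : ℝ}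
    (h : HasDiophantineIndex ξ σ) {γ : ℝ} (hγ : 0 < γ) :
    ∃ c T₀ : ℝ, 0 < c ∧ 1 ≤ T₀ ∧ ∀ T : ℝ, T₀ ≤ T → ∃ q : ℕ, 0 < q ∧ c * T ≤ (q : ℝ) ^ σ ∧
      1 / 2 * ∫ x, (singularDist x + 21 / q) ^ (-γ) ≤ birkhoffMean γ ξ T := by
  have hξ0 := abs_pos.2 h.apply_zero_ne_zero
  obtain ⟨c, hc, hper⟩ := h.exists_isAlmostPeriod
  refine ⟨c * |ξ 0| / 2, max 1 (1 / |ξ 0|), by positivity, le_max_left _ _, fun T hT => ?_⟩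
  have hT1 : 1 ≤ T := (le_max_left _ _).trans hT
  have hT2 : 1 ≤ |ξ 0| * T := by
    have := (le_max_right _ _).trans hT
    rw [div_le_iff₀ hξ0] at this
    linarith
  have hT0 : 0 < T := by linarith
  -- The denominator bound ⌊|ξ 0| * T⌋₊ is the largest that guarantees L ≤ T.
  have hn : 0 < ⌊|ξ 0| * T⌋₊ := Nat.floor_pos.2 hT2
  obtain ⟨m, L, hL, hLeq, hmn, hcn⟩ := hper _ hn
  have hqabs : (((m 0).natAbs : ℕ) : ℝ) = |(m 0 : ℝ)| := by rw [Nat.cast_natAbs, Int.cast_abs]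
  refine ⟨(m 0).natAbs, Int.natAbs_pos.2 hL.ne_zero, ?_, ?_⟩
  · rw [hqabs]
    refine le_trans ?_ hcn
    have h3 := Nat.lt_floor_add_one (|ξ 0| * T)
    have h4 : (1 : ℝ) ≤ ⌊|ξ 0| * T⌋₊ := by exact_mod_cast hn
    have h5 : |ξ 0| * T / 2 ≤ ⌊|ξ 0| * T⌋₊ := by linarith
    have := mul_le_mul_of_nonneg_left h5 hc.le
    linarith
  · rw [hqabs]
    have hq0 : 0 < |(m 0 : ℝ)| := abs_pos.2 (by exact_mod_cast hL.ne_zero)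
    set q := |(m 0 : ℝ)| with hq
    have hLT : L ≤ T := by
      rw [hLeq, div_le_iff₀ hξ0]
      have := Nat.floor_le (show 0 ≤ |ξ 0| * T by positivity)
      linarith
    have hpos : ∀ x, 0 < singularDist x + 21 / q := fun x =>
      add_pos_of_nonneg_of_pos (singularDist_nonneg x) (by positivity)
    -- Cutting off at 1 / q makes the function continuous. A displacement 2 / q changes w by at most
    -- 20 / q, whence 21 / q.
    have hgc := continuous_max_singularDist_rpow (show 0 < 1 / q by positivity) γ
    have h1 := hL.half_mul_integral_le hgc
      (h := fun x => (singularDist x + 21 / q) ^ (-γ))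
      ((continuous_singularDist.add continuous_const).rpow_const fun x => Or.inl (hpos x).ne')
      (fun x y hxy => by
        refine Real.rpow_le_rpow_of_nonpos (lt_max_of_lt_right (by positivity)) ?_ (by linarith)
        have h2 := le_singularDist_add x y
        have h3 : 10 * (2 / q) + 1 / q = 21 / q := by ring
        have h4 : 0 < 1 / q := by positivity
        refine max_le ?_ ?_
        · linarith
        · have h5 : 1 / q ≤ 21 / q := by gcongr; norm_num
          linarith [singularDist_nonneg y])
      (fun x => by positivity) (fun x => Real.rpow_nonneg (hpos x).le _) hLT
    rw [birkhoffMean_eq, one_div T, ← div_eq_inv_mul, le_div_iff₀ hT0]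
    calc _ = _ := by ring
      _ ≤ _ := h1
      _ ≤ _ := by
        refine intervalIntegral.integral_mono_on hT0.le
          ((hgc.comp (continuous_torusFlow ξ)).intervalIntegrable _ _)
          ((h.continuous_rpow_neg γ).intervalIntegrable _ _) fun t _ => ?_
        exact Real.rpow_le_rpow_of_nonpos (h.singularDist_torusFlow_pos t) (le_max_left _ _)
          (by linarith)

theorem continuous_singularDist_add_rpow {a : ℝ} (ha : 0 < a) (γ : ℝ) :
    Continuous fun x => (singularDist x + a) ^ (-γ) :=
  (continuous_singularDist.add continuous_const).rpow_const
    fun x => Or.inl (add_pos_of_nonneg_of_pos (singularDist_nonneg x) ha).ne'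

theorem measurableSet_singularDist_le (r : ℝ) : MeasurableSet {x | singularDist x ≤ r} :=
  measurableSet_le continuous_singularDist.measurable measurable_const

/-- Only the set w ≤ 1 / q is kept: its volume is at least 1 / (25 q²), and the integrand there is
at least (22 / q)^(-γ). -/
theorem rpow_le_integral_singularDist_add {γ : ℝ} (hγ : 0 < γ) {q : ℝ} (hq : 1 ≤ q) :
    22 ^ (-γ) / 25 * q ^ (γ - 2) ≤ ∫ x, (singularDist x + 21 / q) ^ (-γ) := by
  have hq0 : 0 < q := by linarith
  have ha : 0 < 21 / q := by positivity
  have hpos : ∀ x, 0 < singularDist x + 21 / q := fun x =>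
      add_pos_of_nonneg_of_pos (singularDist_nonneg x) ha
  have hint : Integrable fun x => (singularDist x + 21 / q) ^ (-γ) :=
    (continuous_singularDist_add_rpow ha γ).integrable_of_hasCompactSupport
      (HasCompactSupport.of_compactSpace _)
  have hvol := le_volume_real_singularDist_le (r := 1 / q) (by positivity)
    (((div_le_one hq0).2 hq).trans (by norm_num))
  calc 22 ^ (-γ) / 25 * q ^ (γ - 2) = (1 / q / 5) ^ 2 * (22 / q) ^ (-γ) := by
        rw [Real.div_rpow (by norm_num) hq0.le, Real.rpow_neg hq0.le, Real.rpow_sub hq0,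
          Real.rpow_two]
        field_simp
        norm_num
    _ ≤ volume.real {x | singularDist x ≤ 1 / q} * (22 / q) ^ (-γ) := by gcongr
    _ = ∫ x, ({x | singularDist x ≤ 1 / q}).indicator (fun _ => (22 / q) ^ (-γ)) x := by
        rw [integral_indicator_const _ (measurableSet_singularDist_le _), smul_eq_mul]
    _ ≤ _ := by
      refine integral_mono ((integrable_const _).indicator (measurableSet_singularDist_le _)) hint
        fun x => ?_
      by_cases hx : singularDist x ≤ 1 / q
      · rw [Set.indicator_of_mem (by exact hx)]
        refine Real.rpow_le_rpow_of_nonpos (hpos x) ?_ (by linarith)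
        have : 1 / q + 21 / q = 22 / q := by ring
        linarith
      · rw [Set.indicator_of_notMem (by exact hx)]
        exact Real.rpow_nonneg (hpos x).le _

theorem HasDiophantineIndex.exists_rpow_le_birkhoffMean {ξ : Fin 2 → ℝ}
    (h : HasDiophantineIndex ξ 2) {γ τ : ℝ} (hγ : 2 < γ) (hτ0 : 0 ≤ τ) (hτ : τ ≤ (γ - 2) / 2) :
    ∃ C : ℝ, 0 < C ∧ ∀ T : ℝ, 0 < T → C * T ^ τ ≤ birkhoffMean γ ξ T := by
  have hγ0 : 0 < γ := by linarith
  obtain ⟨c, T₀, hc, hT₀, hlarge⟩ := h.exists_half_integral_le_birkhoffMean hγ0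
  set C₁ := 1 / 2 * (22 ^ (-γ) / 25 * c ^ ((γ - 2) / 2)) with hC₁
  have hC₁0 : 0 < C₁ := by positivity
  refine ⟨min C₁ (2 ^ (-γ) / T₀ ^ τ), by positivity, fun T hT => ?_⟩
  rcases le_total T₀ T with h1 | h1
  · obtain ⟨q, hq, hcq, hle⟩ := hlarge T h1
    have hq1 : (1 : ℝ) ≤ q := by exact_mod_cast hq
    have h2 : (c * T) ^ ((γ - 2) / 2) ≤ (q : ℝ) ^ (γ - 2) := by
      calc _ ≤ ((q : ℝ) ^ (2 : ℝ)) ^ ((γ - 2) / 2) := by gcongr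
        _ = _ := by
          rw [← Real.rpow_mul (by positivity)]
          congr 1; ring
    rw [Real.mul_rpow hc.le hT.le] at h2
    have h3 : T ^ τ ≤ T ^ ((γ - 2) / 2) :=
      Real.rpow_le_rpow_of_exponent_le (hT₀.trans h1) hτ
    calc _ ≤ C₁ * T ^ ((γ - 2) / 2) := by gcongr; exact min_le_left _ _
      _ = 1 / 2 * (22 ^ (-γ) / 25 * (c ^ ((γ - 2) / 2) * T ^ ((γ - 2) / 2))) := by rw [hC₁]; ring
      _ ≤ 1 / 2 * (22 ^ (-γ) / 25 * (q : ℝ) ^ (γ - 2)) := by gcongr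
      _ ≤ 1 / 2 * ∫ x, (singularDist x + 21 / q) ^ (-γ) := by
        gcongr
        exact rpow_le_integral_singularDist_add hγ0 hq1
      _ ≤ _ := hle
  · have hT₀0 : 0 < T₀ := by linarith
    calc _ ≤ 2 ^ (-γ) / T₀ ^ τ * T₀ ^ τ := by gcongr; exact min_le_right _ _
      _ = 2 ^ (-γ) := by field_simp
      _ ≤ _ := h.le_birkhoffMean hγ0 hT

/-- The sum is geometric and dominated by its last nonzero term, so it is bounded by multiples of
both 4^J and w^(-2): a dyadic minorant of the regularised inverse square. -/
theorem sum_four_pow_indicator_le {w : ℝ} (hw : 0 ≤ w) (J : ℕ) :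
    (∑ j ∈ Finset.range J, if w ≤ (1 / 2) ^ j then (4 : ℝ) ^ j else 0) ≤ 4 ^ J / 3 ∧
    (∑ j ∈ Finset.range J, if w ≤ (1 / 2) ^ j then (4 : ℝ) ^ j else 0) * w ^ 2 ≤ 4 / 3 := by
  induction J with
  | zero => constructor <;> norm_num
  | succ J ih =>
    rw [Finset.sum_range_succ]
    set S := ∑ j ∈ Finset.range J, if w ≤ (1 / 2) ^ j then (4 : ℝ) ^ j else 0
    have h4 : (0 : ℝ) < 4 ^ J := by positivity
    split_ifs with hJ
    · have h1 : S + 4 ^ J ≤ 4 ^ (J + 1) / 3 := by rw [pow_succ]; linarith [ih.1]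
      refine ⟨h1, ?_⟩
      calc (S + 4 ^ J) * w ^ 2 ≤ 4 ^ (J + 1) / 3 * ((1 / 2) ^ J) ^ 2 := by gcongr
        _ = 4 / 3 * (4 * (1 / 2) ^ 2) ^ J := by rw [mul_pow, ← pow_mul, ← pow_mul, mul_comm 2 J]; ring
        _ = 4 / 3 := by norm_num
    · rw [add_zero]
      refine ⟨ih.1.trans ?_, ih.2⟩
      rw [pow_succ]; linarith

/-- Each of about log₂ q dyadic scales contributes at least 1 / 25 to the integral of the sum, and
the sum is at most 300 (w + 21 / q)^(-2); 7500 = 25 · 300. -/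
theorem log_le_integral_singularDist_add {q : ℕ} (hq : 0 < q) :
    (Real.log q - 1) / 7500 ≤ ∫ x, (singularDist x + 21 / q) ^ (-2 : ℝ) := by
  have hq0 : (0 : ℝ) < q := by exact_mod_cast hq
  have ha : 0 < 21 / (q : ℝ) := by positivity
  have hpos : ∀ x, 0 < singularDist x + 21 / q := fun x =>
      add_pos_of_nonneg_of_pos (singularDist_nonneg x) ha
  have hint : Integrable fun x => (singularDist x + 21 / q) ^ (-2 : ℝ) :=
    (continuous_singularDist_add_rpow ha 2).integrable_of_hasCompactSupport
      (HasCompactSupport.of_compactSpace _)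
  set J := Nat.log 2 q with hJ
  have hJq : ((2 : ℝ)) ^ J ≤ q := by exact_mod_cast Nat.pow_log_le_self 2 hq.ne'
  have hqJ : (q : ℝ) < 2 ^ (J + 1) := by exact_mod_cast Nat.lt_pow_succ_log_self (by norm_num) q
  have hlog : Real.log q - 1 ≤ J := by
    have h1 := Real.log_le_log hq0 hqJ.le
    rw [Real.log_pow] at h1
    have h2 := Real.log_two_lt_d9
    push_cast at h1
    have : ((J : ℝ) + 1) * Real.log 2 ≤ (J + 1) * 1 := by gcongr; linarith
    linarith
  have hind : ∀ j : ℕ, (fun x => if singularDist x ≤ (1 / 2) ^ j then (4 : ℝ) ^ j else 0)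
      = ({x | singularDist x ≤ (1 / 2) ^ j}).indicator fun _ => (4 : ℝ) ^ j := by
    intro j
    ext x
    by_cases hx : singularDist x ≤ (1 / 2) ^ j
    · rw [Set.indicator_of_mem (by exact hx), if_pos hx]
    · rw [Set.indicator_of_notMem (by exact hx), if_neg hx]
  have hintj : ∀ j : ℕ,
      Integrable (fun x => if singularDist x ≤ (1 / 2) ^ j then (4 : ℝ) ^ j else 0) := by
    intro j
    rw [hind]
    exact (integrable_const _).indicator (measurableSet_singularDist_le _)
  have hj : ∀ j : ℕ, 1 / 25 ≤ ∫ x, if singularDist x ≤ (1 / 2) ^ j then (4 : ℝ) ^ j else 0 := by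
    intro j
    rw [hind, integral_indicator_const _ (measurableSet_singularDist_le _), smul_eq_mul]
    have h1 : ((1 : ℝ) / 2) ^ j ≤ 1 := pow_le_one₀ (by norm_num) (by norm_num)
    calc (1 : ℝ) / 25 = ((1 / 2) ^ j / 5) ^ 2 * 4 ^ j := by
          rw [div_pow, ← pow_mul, mul_comm j 2, pow_mul, div_mul_eq_mul_div, ← mul_pow]
          norm_num
      _ ≤ _ := by
        gcongr
        exact le_volume_real_singularDist_le (by positivity) (by linarith)
  calc (Real.log q - 1) / 7500 ≤ J / 7500 := by gcongr
    _ = (∑ _j ∈ Finset.range J, (1 : ℝ) / 25) / 300 := by simp; ring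
    _ ≤ (∑ j ∈ Finset.range J,
        ∫ x, if singularDist x ≤ (1 / 2) ^ j then (4 : ℝ) ^ j else 0) / 300 := by
      gcongr with j
      exact hj j
    _ = ∫ x, (∑ j ∈ Finset.range J, if singularDist x ≤ (1 / 2) ^ j then (4 : ℝ) ^ j else 0) / 300 := by
      rw [integral_div, integral_finsetSum _ fun j _ => hintj j]
    _ ≤ _ := by
      refine integral_mono ((integrable_finsetSum _ fun j _ => hintj j).div_const _) hint
        fun x => ?_
      have hw := singularDist_nonneg x
      obtain ⟨h1, h2⟩ := sum_four_pow_indicator_le hw J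
      have h0 : 0 ≤ ∑ j ∈ Finset.range J,
          if singularDist x ≤ (1 / 2) ^ j then (4 : ℝ) ^ j else 0 :=
        Finset.sum_nonneg fun j _ => by positivity
      simp only
      rw [Real.rpow_neg (hpos x).le, Real.rpow_two, ← one_div, le_div_iff₀ (by have := hpos x; positivity)]
      generalize (∑ j ∈ Finset.range J,
          if singularDist x ≤ (1 / 2) ^ j then (4 : ℝ) ^ j else 0) = S at *
      generalize singularDist x = w at *
      -- Here 147 = 21² / 3; with S w² ≤ 4 / 3 this gives S (w + 21 / q)² ≤ 8 / 3 + 294 < 300.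
      have h3 : S * (21 / q) ^ 2 ≤ 147 := by
        calc S * (21 / q) ^ 2 ≤ 4 ^ J / 3 * (21 / 2 ^ J) ^ 2 := by gcongr
          _ = 147 * (4 ^ J / (2 ^ J) ^ 2) := by ring
          _ = 147 := by
            rw [← pow_mul, mul_comm J 2, pow_mul]
            norm_num
      have h4 : (w + 21 / q) ^ 2 ≤ 2 * w ^ 2 + 2 * (21 / q) ^ 2 := by
        nlinarith [sq_nonneg (w - 21 / (q : ℝ))]
      have := mul_le_mul_of_nonneg_left h4 h0
      linarith

theorem HasDiophantineIndex.exists_log_le_birkhoffMean {ξ : Fin 2 → ℝ}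
    (h : HasDiophantineIndex ξ 1) :
    ∃ C : ℝ, 0 < C ∧ ∀ T : ℝ, 1 ≤ T → C * |Real.log T| ≤ birkhoffMean 2 ξ T := by
  obtain ⟨c, T₀, hc, hT₀, hlarge⟩ := h.exists_half_integral_le_birkhoffMean two_pos
  -- Beyond T₁ one has log q - 1 ≥ log T + log c - 1 ≥ (log T) / 2, which gives 1 / 30000. Below T₁
  -- the bound w ≤ 2 gives the mean at least 1 / 4.
  set T₁ := max T₀ (Real.exp (2 * (1 - Real.log c))) with hT₁
  have hT₁T₀ : T₀ ≤ T₁ := le_max_left _ _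
  have hlog₁ : 0 ≤ Real.log T₁ := Real.log_nonneg (hT₀.trans hT₁T₀)
  refine ⟨min (1 / 30000) (1 / 4 / (1 + Real.log T₁)), by positivity, fun T hT => ?_⟩
  have hT0 : 0 < T := by linarith
  have hlog : 0 ≤ Real.log T := Real.log_nonneg hT
  rw [abs_of_nonneg hlog]
  rcases le_total T₁ T with h1 | h1
  · obtain ⟨q, hq, hcq, hle⟩ := hlarge T (hT₁T₀.trans h1)
    rw [Real.rpow_one] at hcq
    have h2 := Real.log_le_log (by positivity) hcq
    rw [Real.log_mul hc.ne' hT0.ne'] at h2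
    have h3 : 2 * (1 - Real.log c) ≤ Real.log T := by
      rw [Real.le_log_iff_exp_le hT0]
      exact (le_max_right _ _).trans h1
    have h4 := log_le_integral_singularDist_add hq
    calc _ ≤ 1 / 30000 * Real.log T := by gcongr; exact min_le_left _ _
      _ ≤ 1 / 2 * ((Real.log q - 1) / 7500) := by linarith
      _ ≤ 1 / 2 * ∫ x, (singularDist x + 21 / q) ^ (-2 : ℝ) := by gcongr
      _ ≤ _ := hle
  · have h2 := Real.log_le_log hT0 h1
    calc _ ≤ 1 / 4 / (1 + Real.log T₁) * (1 + Real.log T₁) := by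
          gcongr
          · exact min_le_right _ _
          · linarith
      _ = 1 / 4 := by field_simp
      _ = 2 ^ (-2 : ℝ) := by rw [Real.rpow_neg (by norm_num), Real.rpow_two]; norm_num
      _ ≤ _ := h.le_birkhoffMean two_pos hT0

/-! ### Comparison of exponents and the theorem. -/

theorem growthExponent_nonneg {γ : ℝ} (hγ : 2 < γ) : 0 ≤ growthExponent γ := by
  have h1 : 0 ≤ (γ - 2) * (3 * γ - 2) := mul_nonneg (by linarith) (by linarith)
  unfold growthExponent
  positivity

theorem growthExponent_le {γ : ℝ} (hγ : 2 < γ) : growthExponent γ ≤ (γ - 2) / 2 := by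
  have h1 : 0 ≤ (γ - 2) * (3 * γ - 2) := mul_nonneg (by linarith) (by linarith)
  unfold growthExponent
  rw [div_le_iff₀ (by positivity)]
  -- After clearing denominators, 7γ² - 14γ + 8 = 7 (γ - 1)² + 1 is the factor whose sign matters.
  have h2 : 0 ≤ (γ - 2) * (7 * (γ - 1) ^ 2 + 1) := mul_nonneg (by linarith) (by positivity)
  nlinarith

theorem mainTheorem3 :
    (∀ ξ : Fin 2 → ℝ, HasDiophantineIndex ξ 1 → ∀ γ : ℝ, 0 < γ →
      WellDefinedAlongFlow γ ξ ∧
      (2 < γ → ∃ C : ℝ, 0 < C ∧ ∀ T : ℝ, 0 < T →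
        C * T ^ growthExponent γ ≤ birkhoffMean γ ξ T) ∧
      (γ = 2 → ∃ C : ℝ, 0 < C ∧ ∀ T : ℝ, 1 ≤ T →
        C * |Real.log T| ≤ birkhoffMean γ ξ T) ∧
      (γ < 2 → Integrable (fun x : UnitAddTorus (Fin 2) => 1 / √(prototypeU γ x)) volume) ∧
      (1 ≤ γ → γ < 2 → ∃ C : ℝ, 0 < C ∧ ∀ T : ℝ, 0 < T →
        |birkhoffMean γ ξ T - torusMean γ| ≤ C * T ^ (-(1 / 2 * ((2 - γ) / (2 + γ))))) ∧
      (2 / 3 < γ → γ < 1 → ∃ C : ℝ, 0 < C ∧ ∀ T : ℝ, 0 < T →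
        |birkhoffMean γ ξ T - torusMean γ| ≤
          C * T ^ (-(γ / (1 + γ) * ((2 - γ) / (2 + γ))))) ∧
      (γ = 2 / 3 → ∃ C : ℝ, 0 < C ∧ ∀ T : ℝ, 2 ≤ T →
        |birkhoffMean γ ξ T - torusMean γ| ≤ C * T ^ (-(1 / 5 : ℝ)) * |Real.log T|) ∧
      (γ < 2 / 3 → ∃ C : ℝ, 0 < C ∧ ∀ T : ℝ, 0 < T →
        |birkhoffMean γ ξ T - torusMean γ| ≤ C * T ^ (-(1 / 2 * (γ / (1 + γ)))))) ∧
    (∀ ξ : Fin 2 → ℝ, (∃ σ : ℝ, σ < 2 ∧ HasDiophantineIndex ξ σ) → ∀ γ : ℝ, 2 < γ →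
      WellDefinedAlongFlow γ ξ ∧
      ∃ C : ℝ, 0 < C ∧ ∀ T : ℝ, 0 < T →
        C * T ^ growthExponent γ ≤ birkhoffMean γ ξ T) := by
  refine ⟨fun ξ h γ hγ0 => ⟨h.wellDefinedAlongFlow γ, ?_, ?_, ?_, ?_, ?_, ?_, ?_⟩, ?_⟩
  · intro hγ
    exact (h.mono (by norm_num)).exists_rpow_le_birkhoffMean hγ (growthExponent_nonneg hγ)
      (growthExponent_le hγ)
  · rintro rfl
    exact h.exists_log_le_birkhoffMean
  · intro hγ
    simpa only [one_div_sqrt_prototypeU] using integrable_singularDist_rpow hγ0 hγ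
  · intro h1 hγ
    have h2 : 0 ≤ 2 - γ := by linarith
    refine h.exists_abs_birkhoffMean_sub_le hγ0 hγ (by positivity) ?_
    have h3 : (2 - γ) / (2 + γ) ≤ (2 - γ) / 3 := by gcongr; linarith
    linarith
  · intro _ hγ
    have h2 : 0 ≤ 2 - γ := by linarith
    refine h.exists_abs_birkhoffMean_sub_le hγ0 (by linarith) (by positivity) ?_
    -- The comparison amounts to 6γ ≤ (1 + γ)(2 + γ), that is (1 - γ)(2 - γ) ≥ 0.
    rw [div_mul_div_comm, div_le_div_iff₀ (by positivity) (by norm_num)]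
    nlinarith [mul_nonneg h2 (mul_nonneg (show 0 ≤ 1 - γ by linarith) (show 0 ≤ 2 - γ by linarith))]
  · rintro rfl
    -- At γ = 2/3 the available exponent is 2/9 > 1/5, so the logarithm is used only through |log T|
    -- ≥ log 2.
    obtain ⟨C, hC, hle⟩ := h.exists_abs_birkhoffMean_sub_le hγ0 (τ := 1 / 5) (by norm_num)
      (by norm_num) (by norm_num)
    have hlog2 : 0 < Real.log 2 := Real.log_pos (by norm_num)
    refine ⟨C / Real.log 2, by positivity, fun T hT => (hle T (by linarith)).trans ?_⟩
    have h1 : Real.log 2 ≤ |Real.log T| :=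
      (Real.log_le_log (by norm_num) hT).trans (le_abs_self _)
    calc C * T ^ (-(1 / 5 : ℝ)) = C / Real.log 2 * T ^ (-(1 / 5 : ℝ)) * Real.log 2 := by field_simp
      _ ≤ _ := by gcongr
  · intro hγ
    refine h.exists_abs_birkhoffMean_sub_le hγ0 (by linarith) (by positivity) ?_
    -- The comparison amounts to γ² + 2γ ≤ 2, which holds for γ < 2/3.
    rw [one_div_mul_eq_div, div_div, div_le_div_iff₀ (by positivity) (by norm_num)]
    nlinarith
  · rintro ξ ⟨σ, hσ, h⟩ γ hγ
    exact ⟨h.wellDefinedAlongFlow γ, (h.mono hσ.le).exists_rpow_le_birkhoffMean hγ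
      (growthExponent_nonneg hγ) (growthExponent_le hγ)⟩
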